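/- Let $\mathcal D$ be a countably infinite set of uninterpreted constants (concretely, finite strings) and let $\mathcal Q$ be the set of rational numbers. A relation schema is a list $U_1,\dots,U_k$ with each $U_i\in\{\mathcal D,\mathcal Q\}$, and its tuples are the elements of $U_1\times\cdots\times U_k$. An ERO formula is a first-order formula (with $\bot,\neg,\wedge,\vee$ and quantifiers over $\mathcal D$ and over $\mathcal Q$ allowed) whose atomic formulas are equality constraints $x=y$, $x\neq y$, $x=c$, $x\neq c$ with $\mathcal D$-variables $x,y$ and a constant $c\in\mathcal D$, and rational-order constraints $x\,\lambda\, y$, $x\,\lambda\, c$ with $\lambda\in\{=,\neq,<,>,\leq,\geq\}$, $\mathcal Q$-variables $x,y$ and a rational constant $c$. An ERO preference formula $C(t_1,t_2)$ over the schema is an ERO formula whose free variables are attributes of the tuples $t_1$ and $t_2$, used according to their domains; it defines the preference relation $t_1\succ_C t_2 \iff C(t_1,t_2)$ on tuples. A strict partial order is an irreflexive transitive relation; an interval order is a strict partial order $\succ$ such that $x\succ y$ and $z\succ w$ imply $x\succ w$ or $z\succ y$; a weak order is a strict partial order $\succ$ such that $x\not\succ y$ and $y\not\succ z$ imply $x\not\succ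 z$. **Theorem.** Every interval order preference relation $\succ$ that is defined by an ERO preference formula $C$ over a relation schema has a weak order extension $\succ'$ (that is, a weak order $\succ'$ on the same tuples with ${\succ}\subseteq{\succ'}$) that is defined by a quantifier-free ERO preference formula $C'$ over the same schema. Moreover, $C'$ can be computed from $C$ in exponential time: there are a single algorithm and a polynomial $p$ such that for every schema and every such $C$, the algorithm on input $C$ stops after at most $2^{p(|C|)}$ steps with such a formula $C'$ as its output, where $|C|$ is the size of $C$ with all numbers written in binary. -/

import Mathlib

namespace EROPref

/-! ## Properties of preference relations -/

/-- Strict partial orders: irreflexive and transitive relations. -/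
structure IsSPO {α : Type*} (r : α → α → Prop) : Prop where
  irrefl : ∀ x, ¬ r x x
  trans : ∀ x y z, r x y → r y z → r x z

/-- Interval orders. -/
structure IsIntervalOrder {α : Type*} (r : α → α → Prop) : Prop extends IsSPO r where
  interval : ∀ x y z w, r x y → r z w → r x w ∨ r z y

/-- Weak orders: negatively transitive strict partial orders. -/
structure IsWeakOrder {α : Type*} (r : α → α → Prop) : Prop extends IsSPO r where
  negTrans : ∀ x y z, ¬ r x y → ¬ r y z → ¬ r x z

/-! ## Domains, schemas, tuples -/

/-- The countably infinite domain `𝒟` of uninterpreted constants: finite bit strings, of which the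
formulas below can only test equality. -/
abbrev Const : Type := List Bool

/-- The two kinds of attribute domains: `𝒟` and `𝒬`. -/
inductive Dom : Type
  | D
  | Q

/-- The set of values of a domain. -/
def Dom.Carrier : Dom → Type
  | .D => Const
  | .Q => ℚ

/-- Tuples over the relation schema `R(A_0, …, A_{k-1})` in which `A_i` has domain `U i`. -/
abbrev Tuple {k : ℕ} (U : Fin k → Dom) : Type := (i : Fin k) → (U i).Carrier

/-! ## Syntax of ERO formulas -/

/-- Variables. `left i` and `right i` stand for the value of the `i`-th attribute in the first and
in the second tuple that are being compared; `bound n` are the variables that quantifiers bind.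
A variable in an equality constraint is a `𝒟`-variable, and a variable in a rational-order
constraint is a `𝒬`-variable; the `𝒟`-variable `bound n` and the `𝒬`-variable `bound n` are
different variables. -/
inductive Var : Type
  | left (i : ℕ)
  | right (i : ℕ)
  | bound (n : ℕ)
  deriving DecidableEq

/-- The relation symbols of equality constraints: `=`, `≠`. -/
inductive EqRel : Type
  | eq
  | ne

/-- The relation symbols of rational-order constraints: `=`, `≠`, `<`, `>`, `≤`, `≥`. -/
inductive OrdRel : Type
  | eq
  | ne
  | lt
  | gt
  | le
  | ge

/-- First-order formulas over equality constraints and rational-order constraints. -/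
inductive ERO : Type
  | fls
  | eqVar (r : EqRel) (x y : Var)
  | eqConst (r : EqRel) (x : Var) (c : Const)
  | ordVar (r : OrdRel) (x y : Var)
  | ordConst (r : OrdRel) (x : Var) (c : ℚ)
  | not (φ : ERO)
  | and (φ ψ : ERO)
  | or (φ ψ : ERO)
  | exD (n : ℕ) (φ : ERO)
  | exQ (n : ℕ) (φ : ERO)
  | allD (n : ℕ) (φ : ERO)
  | allQ (n : ℕ) (φ : ERO)

namespace ERO

/-- The free `𝒟`-variables. -/
def freeD : ERO → Set Var
  | fls => ∅
  | eqVar _ x y => {x, y}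
  | eqConst _ x _ => {x}
  | ordVar _ _ _ => ∅
  | ordConst _ _ _ => ∅
  | not φ => φ.freeD
  | and φ ψ => φ.freeD ∪ ψ.freeD
  | or φ ψ => φ.freeD ∪ ψ.freeD
  | exD n φ => φ.freeD \ {Var.bound n}
  | exQ _ φ => φ.freeD
  | allD n φ => φ.freeD \ {Var.bound n}
  | allQ _ φ => φ.freeD

/-- The free `𝒬`-variables. -/
def freeQ : ERO → Set Var
  | fls => ∅
  | eqVar _ _ _ => ∅
  | eqConst _ _ _ => ∅
  | ordVar _ x y => {x, y}
  | ordConst _ x _ => {x}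
  | not φ => φ.freeQ
  | and φ ψ => φ.freeQ ∪ ψ.freeQ
  | or φ ψ => φ.freeQ ∪ ψ.freeQ
  | exD _ φ => φ.freeQ
  | exQ n φ => φ.freeQ \ {Var.bound n}
  | allD _ φ => φ.freeQ
  | allQ n φ => φ.freeQ \ {Var.bound n}

/-- Formulas without quantifiers. -/
def QuantifierFree : ERO → Prop
  | fls => True
  | eqVar _ _ _ => True
  | eqConst _ _ _ => True
  | ordVar _ _ _ => True
  | ordConst _ _ _ => True
  | not φ => φ.QuantifierFree
  | and φ ψ => φ.QuantifierFree ∧ ψ.QuantifierFree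
  | or φ ψ => φ.QuantifierFree ∧ ψ.QuantifierFree
  | exD _ _ => False
  | exQ _ _ => False
  | allD _ _ => False
  | allQ _ _ => False

end ERO

/-- The variable stands for an attribute, of domain `s`, of one of the two tuples. -/
def Var.IsAttr {k : ℕ} (U : Fin k → Dom) (s : Dom) : Var → Prop
  | .left i => ∃ h : i < k, U ⟨i, h⟩ = s
  | .right i => ∃ h : i < k, U ⟨i, h⟩ = s
  | .bound _ => False

/-- `φ` is an ERO preference formula `C(t₁, t₂)` over the schema `U`: its free variables are
attributes of `t₁` and `t₂`, used according to their domains. -/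
def ERO.IsPrefFormula {k : ℕ} (U : Fin k → Dom) (φ : ERO) : Prop :=
  (∀ v ∈ φ.freeD, v.IsAttr U .D) ∧ (∀ v ∈ φ.freeQ, v.IsAttr U .Q)

/-! ## Semantics of ERO formulas -/

def EqRel.Holds : EqRel → Const → Const → Prop
  | .eq, a, b => a = b
  | .ne, a, b => a ≠ b

def OrdRel.Holds : OrdRel → ℚ → ℚ → Prop
  | .eq, a, b => a = b
  | .ne, a, b => a ≠ b
  | .lt, a, b => a < b
  | .gt, a, b => a > b
  | .le, a, b => a ≤ b
  | .ge, a, b => a ≥ b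

/-- Truth under an assignment `d` of the `𝒟`-variables and `q` of the `𝒬`-variables. -/
def ERO.Holds : ERO → (Var → Const) → (Var → ℚ) → Prop
  | fls, _, _ => False
  | eqVar r x y, d, _ => r.Holds (d x) (d y)
  | eqConst r x c, d, _ => r.Holds (d x) c
  | ordVar r x y, _, q => r.Holds (q x) (q y)
  | ordConst r x c, _, q => r.Holds (q x) c
  | not φ, d, q => ¬ φ.Holds d q
  | and φ ψ, d, q => φ.Holds d q ∧ ψ.Holds d q
  | or φ ψ, d, q => φ.Holds d q ∨ ψ.Holds d q
  | exD n φ, d, q => ∃ a : Const, φ.Holds (Function.update d (Var.bound n) a) q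
  | exQ n φ, d, q => ∃ a : ℚ, φ.Holds d (Function.update q (Var.bound n) a)
  | allD n φ, d, q => ∀ a : Const, φ.Holds (Function.update d (Var.bound n) a) q
  | allQ n φ, d, q => ∀ a : ℚ, φ.Holds d (Function.update q (Var.bound n) a)

/-- A value of domain `𝒟`; the default is never reached in a preference formula. -/
def Dom.toConst : (s : Dom) → s.Carrier → Const
  | .D, a => a
  | .Q, _ => []

/-- A value of domain `𝒬`; the default is never reached in a preference formula. -/
def Dom.toRat : (s : Dom) → s.Carrier → ℚ
  | .D, _ => 0
  | .Q, a => a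

/-- The assignment of the `𝒟`-variables given by two tuples. -/
def assignD {k : ℕ} {U : Fin k → Dom} (t₁ t₂ : Tuple U) : Var → Const
  | .left i => if h : i < k then (U ⟨i, h⟩).toConst (t₁ ⟨i, h⟩) else []
  | .right i => if h : i < k then (U ⟨i, h⟩).toConst (t₂ ⟨i, h⟩) else []
  | .bound _ => []

/-- The assignment of the `𝒬`-variables given by two tuples. -/
def assignQ {k : ℕ} {U : Fin k → Dom} (t₁ t₂ : Tuple U) : Var → ℚ
  | .left i => if h : i < k then (U ⟨i, h⟩).toRat (t₁ ⟨i, h⟩) else 0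
  | .right i => if h : i < k then (U ⟨i, h⟩).toRat (t₂ ⟨i, h⟩) else 0
  | .bound _ => 0

/-- The preference relation over the schema `U` that is defined by the formula `φ`. -/
def ERO.rel {k : ℕ} (U : Fin k → Dom) (φ : ERO) (t₁ t₂ : Tuple U) : Prop :=
  φ.Holds (assignD t₁ t₂) (assignQ t₁ t₂)

/-! ## Model of computation: first-order functional programs on binary trees -/

/-- The data of the programs: binary trees (Lisp S-expressions with a single atom). -/
inductive BTree : Type
  | leaf
  | node (l r : BTree)
  deriving DecidableEq

namespace BTree

/-- The number of leaves and inner nodes. -/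
def size : BTree → ℕ
  | leaf => 1
  | node l r => l.size + r.size + 1

def head : BTree → BTree
  | leaf => leaf
  | node l _ => l

def tail : BTree → BTree
  | leaf => leaf
  | node _ r => r

/-- Truth values: false is the atom. -/
def ofBool : Bool → BTree
  | false => leaf
  | true => node leaf leaf

/-- Unary numerals, used only for the finitely many tags of the encoding of formulas. -/
def ofTag : ℕ → BTree
  | 0 => leaf
  | n + 1 => node leaf (ofTag n)

end BTree

/-- Expressions, the bodies of functions of one argument. -/
inductive Exp : Type
  | arg
  | nil
  | cons (e f : Exp)
  | hd (e : Exp)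
  | tl (e : Exp)
  | equal (e f : Exp)
  | ite (c e f : Exp)
  | call (i : ℕ) (e : Exp)

/-- A program is a finite list of mutually recursive functions of one argument, given by their
bodies. -/
abbrev Program : Type := List Exp

/-- `Eval P x e v t`: in the program `P`, with the argument bound to `x`, call-by-value evaluation
of the expression `e` stops with the value `v` at cost `t`. Every operation costs `1`, except that
reading the argument costs the size of the tree that is read. So the cost bounds the size of every
tree that is built as well as the depth of the recursion, and it agrees with the running time of
multitape Turing machines up to a polynomial. -/
inductive Eval (P : Program) : BTree → Exp → BTree → ℕ → Prop
  | arg (x : BTree) : Eval P x .arg x x.size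
  | nil (x : BTree) : Eval P x .nil .leaf 1
  | cons {x e f v w s t} : Eval P x e v s → Eval P x f w t →
      Eval P x (.cons e f) (.node v w) (s + t + 1)
  | hd {x e v t} : Eval P x e v t → Eval P x (.hd e) v.head (t + 1)
  | tl {x e v t} : Eval P x e v t → Eval P x (.tl e) v.tail (t + 1)
  | equal {x e f v w s t} : Eval P x e v s → Eval P x f w t →
      Eval P x (.equal e f) (.ofBool (decide (v = w))) (s + t + 1)
  | iteTrue {x c e f a b v s t} : Eval P x c (.node a b) s → Eval P x e v t →
      Eval P x (.ite c e f) v (s + t + 1)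
  | iteFalse {x c e f v s t} : Eval P x c .leaf s → Eval P x f v t →
      Eval P x (.ite c e f) v (s + t + 1)
  | call {x i e body y v s t} : P[i]? = some body → Eval P x e y s → Eval P y body v t →
      Eval P x (.call i e) v (s + t + 1)

/-- On input `x`, the program (its function number `0`) stops with output `y` after `t` steps. -/
def Program.OutputsIn (P : Program) (x y : BTree) (t : ℕ) : Prop :=
  Eval P x (.call 0 .arg) y t

/-! ## Encoding of formulas as trees; all numbers are written in binary -/

/-- Bit strings as trees. -/
def encBits : List Bool → BTree
  | [] => .leaf
  | b :: l => .node (.ofBool b) (encBits l)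

/-- Natural numbers by their binary digits, least significant digit first. -/
def encNat (n : ℕ) : BTree := encBits n.bits

/-- Rational numbers by sign, absolute value of the numerator, and denominator in lowest terms. -/
def encRat (q : ℚ) : BTree :=
  .node (.ofBool (decide (q < 0))) (.node (encNat q.num.natAbs) (encNat q.den))

def Var.enc : Var → BTree
  | .left i => .node (.ofTag 0) (encNat i)
  | .right i => .node (.ofTag 1) (encNat i)
  | .bound n => .node (.ofTag 2) (encNat n)

def EqRel.enc : EqRel → BTree
  | .eq => .ofTag 0
  | .ne => .ofTag 1

def OrdRel.enc : OrdRel → BTree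
  | .eq => .ofTag 0
  | .ne => .ofTag 1
  | .lt => .ofTag 2
  | .gt => .ofTag 3
  | .le => .ofTag 4
  | .ge => .ofTag 5

/-- The syntax tree of a formula. -/
def ERO.enc : ERO → BTree
  | fls => .node (.ofTag 0) .leaf
  | eqVar r x y => .node (.ofTag 1) (.node r.enc (.node x.enc y.enc))
  | eqConst r x c => .node (.ofTag 2) (.node r.enc (.node x.enc (encBits c)))
  | ordVar r x y => .node (.ofTag 3) (.node r.enc (.node x.enc y.enc))
  | ordConst r x c => .node (.ofTag 4) (.node r.enc (.node x.enc (encRat c)))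
  | not φ => .node (.ofTag 5) φ.enc
  | and φ ψ => .node (.ofTag 6) (.node φ.enc ψ.enc)
  | or φ ψ => .node (.ofTag 7) (.node φ.enc ψ.enc)
  | exD n φ => .node (.ofTag 8) (.node (encNat n) φ.enc)
  | exQ n φ => .node (.ofTag 9) (.node (encNat n) φ.enc)
  | allD n φ => .node (.ofTag 10) (.node (encNat n) φ.enc)
  | allQ n φ => .node (.ofTag 11) (.node (encNat n) φ.enc)

end EROPref

open EROPref

/-!
An interval order `≻` has a canonical weak order extension: `t₁ ≻' t₂` if some tuple `t₃` is
dominated by `t₁` and not by `t₂`. The interval condition says that the sets of dominated tuples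
form a chain under inclusion, so `≻'` is the strict comparison of the members of a chain, and `≻` is
contained in it by irreflexivity (`IsIntervalOrder.isWeakOrder`, `IsSPO.exists_rel_and_not_rel`).
If `C` defines `≻`, then `∃ t₃, C(t₁, t₃) ∧ ¬ C(t₂, t₃)` defines `≻'`; this is `ERO.extFm`. It has
quantifiers for those attributes of `t₃` that occur in `C`, which makes the construction independent
of the schema. It remains to eliminate all quantifiers in exponential time.

Quantifiers are eliminated by virtual substitution. To decide `∃ x, φ` for quantifier-free `φ`, it
suffices to test `x` at `-∞`, at the values of the terms `t` that occur in `φ`, and immediately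
above these values (`Fm.holds_elim`). For the domain `𝒟` the same test points work: `-∞` and the
points above `t` stand for a value different from all others; so `𝒟` can be coded by the rational
numbers, and one notion of assignment serves both domains. Elimination introduces no new terms
(`Fm.fv_qe_subset`). Hence the list of the terms to be tested can be read off the given formula
and not the intermediate one, which may already be of exponential size. Eliminating one quantifier
therefore multiplies the size by a factor that is linear in the size `N` of the given formula, and
the result has size at most `(100 N) ^ N` (`Fm.size_qe_le`).

For the running time, `Computes S i o B` says that there is relocatable code that turns the input
`i a` into the output `o a` at a cost polynomial in `B a`. This notion is closed under pairing,
composition, branching and structural recursion (`Computes.pair`, `Computes.comp`, `Computes.ite`,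
`Computes.recur`), so the cost analysis of each operation on formulas reduces to a size bound for
its results. Arithmetic is needed only in the last translation (`computes_toERO`), which
evaluates atoms between two rational constants, by binary multiplication (`computes_ratLt`).
-/

namespace EROPref

/-! ### Call-free expressions -/

/-- Branching on the truth value of a tree. -/
def BTree.cond : BTree → BTree → BTree → BTree
  | .leaf, _, y => y
  | .node _ _, x, _ => x

/-- The value of a call-free expression; calls are given the junk value `leaf`. -/
def Exp.den : Exp → BTree → BTree
  | .arg, x => x
  | .nil, _ => .leaf
  | .cons e f, x => .node (e.den x) (f.den x)
  | .hd e, x => (e.den x).head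
  | .tl e, x => (e.den x).tail
  | .equal e f, x => .ofBool (decide (e.den x = f.den x))
  | .ite c e f, x => (c.den x).cond (e.den x) (f.den x)
  | .call _ _, _ => .leaf

/-- Whether an expression contains no calls. -/
def Exp.callFree : Exp → Bool
  | .arg => true
  | .nil => true
  | .cons e f => e.callFree && f.callFree
  | .hd e => e.callFree
  | .tl e => e.callFree
  | .equal e f => e.callFree && f.callFree
  | .ite c e f => c.callFree && (e.callFree && f.callFree)
  | .call _ _ => false

/-- The number of nodes of an expression. -/
def Exp.len : Exp → ℕ
  | .arg => 1
  | .nil => 1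
  | .cons e f => e.len + f.len + 1
  | .hd e => e.len + 1
  | .tl e => e.len + 1
  | .equal e f => e.len + f.len + 1
  | .ite c e f => c.len + e.len + f.len + 1
  | .call _ e => e.len + 1

theorem BTree.one_le_size (x : BTree) : 1 ≤ x.size := by
  cases x <;> simp [BTree.size]

theorem BTree.size_head_le (x : BTree) : x.head.size ≤ x.size := by
  cases x <;> simp [BTree.size, BTree.head]; omega

theorem BTree.size_tail_le (x : BTree) : x.tail.size ≤ x.size := by
  cases x <;> simp [BTree.size, BTree.tail]; omega

theorem BTree.size_ofBool_le (b : Bool) : (BTree.ofBool b).size ≤ 3 := by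
  cases b <;> simp [BTree.size, BTree.ofBool]

/-- The cost of an evaluation bounds the size of the value. -/
theorem Eval.size_le {P : Program} {x v : BTree} {e : Exp} {t : ℕ} (h : Eval P x e v t) :
    v.size ≤ t := by
  induction h with
  | arg x => exact le_rfl
  | nil x => exact le_rfl
  | cons _ _ ih₁ ih₂ => simp only [BTree.size]; omega
  | hd _ ih => exact (BTree.size_head_le _).trans (by omega)
  | tl _ ih => exact (BTree.size_tail_le _).trans (by omega)
  | @equal x e f v w s t _ _ ih₁ ih₂ =>
    have := BTree.one_le_size v
    have := BTree.one_le_size w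
    exact (BTree.size_ofBool_le _).trans (by omega)
  | iteTrue _ _ ih₁ ih₂ => omega
  | iteFalse _ _ ih₁ ih₂ => omega
  | call _ _ _ ih₁ ih₂ => omega

/-- A call-free expression is evaluated in linear time. -/
theorem Exp.eval_den (P : Program) (x : BTree) (e : Exp) (h : e.callFree = true) :
    ∃ t ≤ e.len * x.size, Eval P x e (e.den x) t := by
  have hx := x.one_le_size
  induction e with
  | arg => exact ⟨_, by simp [Exp.len], .arg x⟩
  | nil => exact ⟨_, by simpa [Exp.len] using hx, .nil x⟩
  | cons e f ihe ihf =>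
    simp only [Exp.callFree, Bool.and_eq_true] at h
    obtain ⟨s, hs, he⟩ := ihe h.1
    obtain ⟨t, ht, hf⟩ := ihf h.2
    exact ⟨_, by simp only [Exp.len, add_mul, one_mul]; omega, .cons he hf⟩
  | hd e ih =>
    obtain ⟨s, hs, he⟩ := ih h
    exact ⟨_, by simp only [Exp.len, add_mul, one_mul]; omega, .hd he⟩
  | tl e ih =>
    obtain ⟨s, hs, he⟩ := ih h
    exact ⟨_, by simp only [Exp.len, add_mul, one_mul]; omega, .tl he⟩
  | equal e f ihe ihf =>
    simp only [Exp.callFree, Bool.and_eq_true] at h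
    obtain ⟨s, hs, he⟩ := ihe h.1
    obtain ⟨t, ht, hf⟩ := ihf h.2
    exact ⟨_, by simp only [Exp.len, add_mul, one_mul]; omega, .equal he hf⟩
  | ite c e f ihc ihe ihf =>
    simp only [Exp.callFree, Bool.and_eq_true] at h
    obtain ⟨r, hr, hc⟩ := ihc h.1
    obtain ⟨s, hs, he⟩ := ihe h.2.1
    obtain ⟨t, ht, hf⟩ := ihf h.2.2
    simp only [Exp.den]
    cases hv : c.den x with
    | leaf =>
      rw [hv] at hc
      exact ⟨_, by simp only [Exp.len, add_mul, one_mul]; omega, .iteFalse hc hf⟩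
    | node a b =>
      rw [hv] at hc
      exact ⟨_, by simp only [Exp.len, add_mul, one_mul]; omega, .iteTrue hc he⟩
  | call i e _ => simp [Exp.callFree] at h

/-! ### Families of inputs with polynomially bounded cost -/

/-- `Computes S i o B`: there is code that, for every index `a ∈ S`, turns the input `i a` into the
output `o a` at a cost that is polynomial in `B a`. The code is an expression `e` together with
auxiliary functions `P₁`; it may be placed at any offset `n` of a program, and then works whatever
the functions before and after it are. -/
def Computes {α : Type} (S : Set α) (i o : α → BTree) (B : α → ℕ) : Prop :=
  ∃ k : ℕ, ∀ n : ℕ, ∃ (P₁ : Program) (e : Exp), ∀ P₀ P₂ : Program, P₀.length = n →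
    ∀ a ∈ S, ∃ t ≤ (B a + 2) ^ k, Eval (P₀ ++ P₁ ++ P₂) (i a) e (o a) t

theorem add_pow_le_pow {b s t k l : ℕ} (hs : s ≤ (b + 2) ^ k) (ht : t ≤ (b + 2) ^ l) :
    s + t + 1 ≤ (b + 2) ^ (k + l + 2) := by
  have h1 : (b + 2) ^ k ≤ (b + 2) ^ (k + l) := Nat.pow_le_pow_right (by omega) (by omega)
  have h2 : (b + 2) ^ l ≤ (b + 2) ^ (k + l) := Nat.pow_le_pow_right (by omega) (by omega)
  have h3 : 1 ≤ (b + 2) ^ (k + l) := Nat.one_le_pow _ _ (by omega)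
  have h4 : 4 ≤ (b + 2) ^ 2 := Nat.pow_le_pow_left (show 2 ≤ b + 2 by omega) 2
  calc s + t + 1 ≤ (b + 2) ^ (k + l) * 4 := by omega
    _ ≤ (b + 2) ^ (k + l) * (b + 2) ^ 2 := Nat.mul_le_mul_left _ h4
    _ = _ := (pow_add _ _ _).symm

theorem const_mul_pow_le_pow {b c s k : ℕ} (hs : s ≤ (b + 2) ^ k) :
    c * s ≤ (b + 2) ^ (c + k) := by
  have h1 : c ≤ (b + 2) ^ c :=
    (Nat.lt_two_pow_self).le.trans (Nat.pow_le_pow_left (by omega) c)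
  calc c * s ≤ (b + 2) ^ c * (b + 2) ^ k := Nat.mul_le_mul h1 hs
    _ = _ := (pow_add _ _ _).symm

theorem getElem?_append_cons {P Q : Program} {e : Exp} {n : ℕ} (h : P.length = n) :
    (P ++ e :: Q)[n]? = some e := by
  simp [← h]

namespace Computes

variable {α : Type} {S : Set α} {i o u v : α → BTree} {B : α → ℕ}

theorem congr (h : Computes S i o B) {i' o' : α → BTree}
    (hi : ∀ a ∈ S, i a = i' a) (ho : ∀ a ∈ S, o a = o' a) : Computes S i' o' B := by
  obtain ⟨k, h⟩ := h
  refine ⟨k, fun n ↦ ?_⟩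
  obtain ⟨P₁, e, h⟩ := h n
  refine ⟨P₁, e, fun P₀ P₂ hn a ha ↦ ?_⟩
  rw [← hi a ha, ← ho a ha]
  exact h P₀ P₂ hn a ha

/-- Reindexing, with a polynomially larger bound. -/
theorem comap {β : Type} {T : Set β} {B' : β → ℕ} (h : Computes S i o B) (g : β → α) (j : ℕ)
    (hS : ∀ b ∈ T, g b ∈ S) (hB : ∀ b ∈ T, B (g b) ≤ (B' b + 2) ^ j) :
    Computes T (fun b ↦ i (g b)) (fun b ↦ o (g b)) B' := by
  obtain ⟨k, h⟩ := h
  refine ⟨(j + 2) * k, fun n ↦ ?_⟩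
  obtain ⟨P₁, e, h⟩ := h n
  refine ⟨P₁, e, fun P₀ P₂ hn b hb ↦ ?_⟩
  obtain ⟨t, ht, hE⟩ := h P₀ P₂ hn (g b) (hS b hb)
  refine ⟨t, ht.trans ?_, hE⟩
  rw [pow_mul]
  refine Nat.pow_le_pow_left ?_ k
  have := add_pow_le_pow (hB b hb) (t := 1) (l := 0) (by simp)
  omega

/-- Outputs are of polynomial size, since building them costs at least their size. -/
theorem size_le (h : Computes S i o B) : ∃ k : ℕ, ∀ a ∈ S, (o a).size ≤ (B a + 2) ^ k := by
  obtain ⟨k, h⟩ := h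
  obtain ⟨P₁, e, h⟩ := h 0
  refine ⟨k, fun a ha ↦ ?_⟩
  obtain ⟨t, ht, hE⟩ := h [] [] rfl a ha
  exact hE.size_le.trans ht

/-- Two pieces of code can be placed in one program. -/
theorem both {β : Type} {T : Set β} {i' o' : β → BTree} {B' : β → ℕ}
    (h : Computes S i o B) (h' : Computes T i' o' B') :
    ∃ k k' : ℕ, ∀ n : ℕ, ∃ (P₁ : Program) (e e' : Exp), ∀ P₀ P₂ : Program, P₀.length = n →
      (∀ a ∈ S, ∃ t ≤ (B a + 2) ^ k, Eval (P₀ ++ P₁ ++ P₂) (i a) e (o a) t) ∧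
      (∀ b ∈ T, ∃ t ≤ (B' b + 2) ^ k', Eval (P₀ ++ P₁ ++ P₂) (i' b) e' (o' b) t) := by
  obtain ⟨k, h⟩ := h
  obtain ⟨k', h'⟩ := h'
  refine ⟨k, k', fun n ↦ ?_⟩
  obtain ⟨P₁, e, h⟩ := h n
  obtain ⟨P₁', e', h'⟩ := h' (n + P₁.length)
  refine ⟨P₁ ++ P₁', e, e', fun P₀ P₂ hn ↦ ⟨fun a ha ↦ ?_, fun b hb ↦ ?_⟩⟩
  · simpa using h P₀ (P₁' ++ P₂) hn a ha
  · simpa using h' (P₀ ++ P₁) P₂ (by simp [hn]) b hb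

/-- Call-free expressions. -/
theorem exp (e : Exp) (he : e.callFree = true) (j : ℕ)
    (hs : ∀ a ∈ S, (i a).size ≤ (B a + 2) ^ j) (ho : ∀ a ∈ S, e.den (i a) = o a) :
    Computes S i o B := by
  refine ⟨e.len + j, fun n ↦ ⟨[], e, fun P₀ P₂ _ a ha ↦ ?_⟩⟩
  obtain ⟨t, ht, hE⟩ := Exp.eval_den (P₀ ++ [] ++ P₂) (i a) e he
  exact ⟨t, ht.trans (const_mul_pow_le_pow (hs a ha)), ho a ha ▸ hE⟩

theorem pair (hu : Computes S i u B) (hv : Computes S i v B) :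
    Computes S i (fun a ↦ .node (u a) (v a)) B := by
  obtain ⟨k, k', h⟩ := hu.both hv
  refine ⟨k + k' + 2, fun n ↦ ?_⟩
  obtain ⟨P₁, e, e', h⟩ := h n
  refine ⟨P₁, .cons e e', fun P₀ P₂ hn a ha ↦ ?_⟩
  obtain ⟨h₁, h₂⟩ := h P₀ P₂ hn
  obtain ⟨s, hs, hE⟩ := h₁ a ha
  obtain ⟨t, ht, hE'⟩ := h₂ a ha
  exact ⟨_, add_pow_le_pow hs ht, .cons hE hE'⟩

/-- Composition: the code for `o` is made a function that is called with the value `v a`. -/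
theorem call (hv : Computes S i v B) (ho : Computes S v o B) : Computes S i o B := by
  obtain ⟨k, k', h⟩ := hv.both ho
  refine ⟨k + k' + 2, fun n ↦ ?_⟩
  obtain ⟨P₁, e, e', h⟩ := h n
  refine ⟨P₁ ++ [e'], .call (n + P₁.length) e, fun P₀ P₂ hn a ha ↦ ?_⟩
  obtain ⟨h₁, h₂⟩ := h P₀ ([e'] ++ P₂) hn
  obtain ⟨s, hs, hE⟩ := h₁ a ha
  obtain ⟨t, ht, hE'⟩ := h₂ a ha
  have hP : P₀ ++ (P₁ ++ [e']) ++ P₂ = P₀ ++ P₁ ++ ([e'] ++ P₂) := by simp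
  rw [hP]
  exact ⟨_, add_pow_le_pow hs ht, .call (by simp [← hn]) hE hE'⟩

/-- Calling code for another family of inputs. -/
theorem comp {β : Type} {T : Set β} {i' o' : β → BTree} {B' : β → ℕ} (hv : Computes S i v B)
    (h' : Computes T i' o' B') (g : α → β) (j : ℕ) (hS : ∀ a ∈ S, g a ∈ T)
    (hg : ∀ a ∈ S, v a = i' (g a)) (hB : ∀ a ∈ S, B' (g a) ≤ (B a + 2) ^ j) :
    Computes S i (fun a ↦ o' (g a)) B :=
  hv.call ((h'.comap g j hS hB).congr (fun a ha ↦ (hg a ha).symm) fun _ _ ↦ rfl)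

/-- Postprocessing by a call-free expression. -/
theorem andThen (hv : Computes S i v B) (e : Exp) (he : e.callFree = true)
    (ho : ∀ a ∈ S, e.den (v a) = o a) : Computes S i o B := by
  obtain ⟨k, hk⟩ := hv.size_le
  exact hv.call (.exp e he k hk ho)

/-- Branching on a call-free condition. -/
theorem ite (c : Exp) (hc : c.callFree = true) (j : ℕ)
    (hs : ∀ a ∈ S, (i a).size ≤ (B a + 2) ^ j)
    (h₁ : Computes {a | a ∈ S ∧ c.den (i a) ≠ .leaf} i o B)
    (h₀ : Computes {a | a ∈ S ∧ c.den (i a) = .leaf} i o B) : Computes S i o B := by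
  obtain ⟨k, k', h⟩ := h₁.both h₀
  refine ⟨(c.len + j) + (k + k') + 2, fun n ↦ ?_⟩
  obtain ⟨P₁, e, e', h⟩ := h n
  refine ⟨P₁, .ite c e e', fun P₀ P₂ hn a ha ↦ ?_⟩
  obtain ⟨h₁, h₂⟩ := h P₀ P₂ hn
  obtain ⟨r, hr, hC⟩ := Exp.eval_den (P₀ ++ P₁ ++ P₂) (i a) c hc
  replace hr := hr.trans (const_mul_pow_le_pow (hs a ha))
  cases hv : c.den (i a) with
  | leaf =>
    obtain ⟨t, ht, hE⟩ := h₂ a ⟨ha, hv⟩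
    exact ⟨_, add_pow_le_pow hr (ht.trans (Nat.pow_le_pow_right (by omega) (by omega))),
      .iteFalse (hv ▸ hC) hE⟩
  | node x y =>
    obtain ⟨t, ht, hE⟩ := h₁ a ⟨ha, by simp [hv]⟩
    exact ⟨_, add_pow_le_pow hr (ht.trans (Nat.pow_le_pow_right (by omega) (by omega))),
      .iteTrue (hv ▸ hC) hE⟩

/-- Recursion. The call-free expression `κ` finds out how many recursive calls are made (none, one,
or two), `c₁` and `c₂` compute their arguments, which have indices `d₁ a` and `d₂ a`. The
measure `m` bounds the number of calls, and the bound `B` must not increase along the recursion;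
so it has to be chosen such that it bounds the intermediate results as well. -/
theorem recur (m : α → ℕ) (κ c₁ c₂ : Exp)
    (hκ : κ.callFree = true) (hc₁ : c₁.callFree = true) (hc₂ : c₂.callFree = true) (d₁ d₂ : α → α)
    (hs : ∀ a ∈ S, (i a).size ≤ B a) (hm : ∀ a ∈ S, m a ≤ B a)
    (hcov : ∀ a ∈ S, κ.den (i a) = .leaf ∨
      (κ.den (i a) = .ofTag 1 ∧ d₁ a ∈ S ∧ c₁.den (i a) = i (d₁ a) ∧ B (d₁ a) ≤ B a ∧
        m (d₁ a) < m a) ∨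
      (κ.den (i a) = .ofTag 2 ∧ d₁ a ∈ S ∧ c₁.den (i a) = i (d₁ a) ∧ B (d₁ a) ≤ B a ∧
        d₂ a ∈ S ∧ c₂.den (i a) = i (d₂ a) ∧ B (d₂ a) ≤ B a ∧ m (d₁ a) + m (d₂ a) < m a))
    (base : Computes {a | a ∈ S ∧ κ.den (i a) = .leaf} i o B)
    (one : Computes {a | a ∈ S ∧ κ.den (i a) = .ofTag 1}
      (fun a ↦ .node (i a) (o (d₁ a))) o B)
    (two : Computes {a | a ∈ S ∧ κ.den (i a) = .ofTag 2}
      (fun a ↦ .node (i a) (.node (o (d₁ a)) (o (d₂ a)))) o B) : Computes S i o B := by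
  obtain ⟨k₁, k₂, h₁₂⟩ := one.both two
  obtain ⟨k₀, h₀⟩ := base
  -- `W a` bounds the cost of a call apart from the recursive calls made in it
  let C : ℕ := 2 * κ.len + c₁.len + c₂.len + 10
  let K : ℕ := k₀ + k₁ + k₂
  let W : α → ℕ := fun a ↦ C * (B a + 2) + (B a + 2) ^ K
  have hW : ∀ a, W a * (2 * B a + 1) ≤ (B a + 2) ^ ((C + 1 + K + 2) + 2) := by
    intro a
    have h1 : W a ≤ (B a + 2) ^ (C + 1 + K + 2) := by
      have := add_pow_le_pow (const_mul_pow_le_pow (c := C) (b := B a) (s := B a + 2) (k := 1)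
        (by simp)) (le_refl ((B a + 2) ^ K))
      simp only [W]; omega
    calc W a * (2 * B a + 1) ≤ (B a + 2) ^ (C + 1 + K + 2) * (B a + 2) ^ 2 :=
          Nat.mul_le_mul h1 (by nlinarith)
      _ = _ := (pow_add _ _ _).symm
  refine ⟨(C + 1 + K + 2) + 2, fun n ↦ ?_⟩
  obtain ⟨P₁, e₁, e₂, h₁₂⟩ := h₁₂ (n + 1)
  obtain ⟨P₃, e₀, h₀⟩ := h₀ (n + 1 + P₁.length)
  let body : Exp := .ite κ
    (.ite (.tl κ)
      (.call (n + 1 + P₁.length + P₃.length + 1)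
        (.cons .arg (.cons (.call n c₁) (.call n c₂))))
      (.call (n + 1 + P₁.length + P₃.length) (.cons .arg (.call n c₁)))) e₀
  refine ⟨[body] ++ P₁ ++ P₃ ++ [e₁, e₂], body, fun P₀ P₂ hn a ha ↦ ?_⟩
  set P : Program := P₀ ++ ([body] ++ P₁ ++ P₃ ++ [e₁, e₂]) ++ P₂ with hP
  have hself : P[n]? = some body := by simp [hP, ← hn]
  have hi₁ : P[n + 1 + P₁.length + P₃.length]? = some e₁ := by
    rw [hP, show P₀ ++ ([body] ++ P₁ ++ P₃ ++ [e₁, e₂]) ++ P₂ =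
      (P₀ ++ [body] ++ P₁ ++ P₃) ++ (e₁ :: e₂ :: P₂) by simp]
    exact getElem?_append_cons (by simp; omega)
  have hi₂ : P[n + 1 + P₁.length + P₃.length + 1]? = some e₂ := by
    rw [hP, show P₀ ++ ([body] ++ P₁ ++ P₃ ++ [e₁, e₂]) ++ P₂ =
      (P₀ ++ [body] ++ P₁ ++ P₃ ++ [e₁]) ++ (e₂ :: P₂) by simp]
    exact getElem?_append_cons (by simp; omega)
  replace h₁₂ := h₁₂ (P₀ ++ [body]) (P₃ ++ [e₁, e₂] ++ P₂) (by simp [hn])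
  replace h₀ := h₀ (P₀ ++ [body] ++ P₁) ([e₁, e₂] ++ P₂) (by simp [hn]; omega)
  rw [show P₀ ++ [body] ++ P₁ ++ (P₃ ++ [e₁, e₂] ++ P₂) = P by simp [hP]] at h₁₂
  rw [show P₀ ++ [body] ++ P₁ ++ P₃ ++ ([e₁, e₂] ++ P₂) = P by simp [hP]] at h₀
  obtain ⟨h₁, h₂⟩ := h₁₂
  have key : ∀ N a, a ∈ S → m a ≤ N →
      ∃ t ≤ W a * (2 * m a + 1), Eval P (i a) body (o a) t := by
    intro N
    induction N with
    | zero =>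
      intro a ha hN
      obtain ⟨r, hr, hE⟩ := Exp.eval_den P (i a) κ hκ
      rcases hcov a ha with h | ⟨_, _, _, _, h⟩ | ⟨_, _, _, _, _, _, _, h⟩
      · obtain ⟨t, ht, hE₀⟩ := h₀ a ⟨ha, h⟩
        refine ⟨_, ?_, .iteFalse (h ▸ hE) hE₀⟩
        have h3 : κ.len * (i a).size ≤ κ.len * (B a + 2) :=
          Nat.mul_le_mul_left _ ((hs a ha).trans (by omega))
        have h4 : (B a + 2) ^ k₀ ≤ (B a + 2) ^ K := Nat.pow_le_pow_right (by omega) (by omega)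
        have h5 : W a * 1 ≤ W a * (2 * m a + 1) := Nat.mul_le_mul_left _ (by omega)
        have h6 : W a = 2 * (κ.len * (B a + 2)) + c₁.len * (B a + 2) + c₂.len * (B a + 2) +
          10 * (B a + 2) + (B a + 2) ^ K := by simp only [W, C]; ring
        omega
      · omega
      · omega
    | succ N ih =>
      intro a ha hN
      obtain ⟨r, hr, hE⟩ := Exp.eval_den P (i a) κ hκ
      obtain ⟨s₁, hs₁, hE₁⟩ := Exp.eval_den P (i a) c₁ hc₁
      obtain ⟨s₂, hs₂, hE₂⟩ := Exp.eval_den P (i a) c₂ hc₂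
      have g0 := hs a ha
      have g1 : κ.len * (i a).size ≤ κ.len * (B a + 2) := Nat.mul_le_mul_left _ (by omega)
      have g2 : c₁.len * (i a).size ≤ c₁.len * (B a + 2) := Nat.mul_le_mul_left _ (by omega)
      have g3 : c₂.len * (i a).size ≤ c₂.len * (B a + 2) := Nat.mul_le_mul_left _ (by omega)
      have g4 : (B a + 2) ^ k₀ ≤ (B a + 2) ^ K := Nat.pow_le_pow_right (by omega) (by omega)
      have g5 : (B a + 2) ^ k₁ ≤ (B a + 2) ^ K := Nat.pow_le_pow_right (by omega) (by omega)
      have g6 : (B a + 2) ^ k₂ ≤ (B a + 2) ^ K := Nat.pow_le_pow_right (by omega) (by omega)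
      have h6 : W a = 2 * (κ.len * (B a + 2)) + c₁.len * (B a + 2) + c₂.len * (B a + 2) +
          10 * (B a + 2) + (B a + 2) ^ K := by simp only [W, C]; ring
      have hWmono : ∀ b, B b ≤ B a → W b ≤ W a := fun b hb ↦
        Nat.add_le_add (Nat.mul_le_mul_left _ (by omega)) (Nat.pow_le_pow_left (by omega) _)
      rcases hcov a ha with h | ⟨h, hd₁, hi₁', hB₁, hm₁⟩ |
        ⟨h, hd₁, hi₁', hB₁, hd₂, hi₂', hB₂, hm₁₂⟩
      · obtain ⟨t, ht, hE₀⟩ := h₀ a ⟨ha, h⟩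
        refine ⟨_, ?_, .iteFalse (h ▸ hE) hE₀⟩
        have h5 : W a * 1 ≤ W a * (2 * m a + 1) := Nat.mul_le_mul_left _ (by omega)
        omega
      · obtain ⟨t, ht, hE₀⟩ := h₁ a ⟨ha, h⟩
        obtain ⟨t₁, ht₁, hR₁⟩ := ih (d₁ a) hd₁ (by omega)
        rw [hi₁'] at hE₁
        rw [h] at hE
        refine ⟨_, ?_, .iteTrue hE (.iteFalse (.tl hE) (.call hi₁
          (.cons (.arg _) (.call hself hE₁ hR₁)) hE₀))⟩
        have h7 : W (d₁ a) * (2 * m (d₁ a) + 1) ≤ W a * (2 * m (d₁ a) + 1) :=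
          Nat.mul_le_mul_right _ (hWmono _ hB₁)
        have h8 : W a * (2 * m (d₁ a) + 1 + 1) ≤ W a * (2 * m a + 1) :=
          Nat.mul_le_mul_left _ (by omega)
        rw [Nat.mul_succ] at h8
        omega
      · obtain ⟨t, ht, hE₀⟩ := h₂ a ⟨ha, h⟩
        obtain ⟨t₁, ht₁, hR₁⟩ := ih (d₁ a) hd₁ (by omega)
        obtain ⟨t₂, ht₂, hR₂⟩ := ih (d₂ a) hd₂ (by omega)
        rw [hi₁'] at hE₁
        rw [hi₂'] at hE₂
        rw [h] at hE
        refine ⟨_, ?_, .iteTrue hE (.iteTrue (.tl hE) (.call hi₂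
          (.cons (.arg _) (.cons (.call hself hE₁ hR₁) (.call hself hE₂ hR₂))) hE₀))⟩
        have h7 : W (d₁ a) * (2 * m (d₁ a) + 1) ≤ W a * (2 * m (d₁ a) + 1) :=
          Nat.mul_le_mul_right _ (hWmono _ hB₁)
        have h7' : W (d₂ a) * (2 * m (d₂ a) + 1) ≤ W a * (2 * m (d₂ a) + 1) :=
          Nat.mul_le_mul_right _ (hWmono _ hB₂)
        have h8 : W a * ((2 * m (d₁ a) + 1) + (2 * m (d₂ a) + 1) + 1) ≤ W a * (2 * m a + 1) :=
          Nat.mul_le_mul_left _ (by omega)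
        rw [Nat.mul_succ, Nat.mul_add] at h8
        omega
  obtain ⟨t, ht, hE⟩ := key (m a) a ha le_rfl
  refine ⟨t, ht.trans (le_trans (Nat.mul_le_mul_left _ ?_) (hW a)), hE⟩
  have := hm a ha
  omega

/-- Recursion with at most one recursive call. -/
theorem recur₁ (m : α → ℕ) (κ c : Exp) (hκ : κ.callFree = true) (hc : c.callFree = true)
    (d : α → α) (hs : ∀ a ∈ S, (i a).size ≤ B a) (hm : ∀ a ∈ S, m a ≤ B a)
    (hcov : ∀ a ∈ S, κ.den (i a) = .leaf ∨ (κ.den (i a) = .ofTag 1 ∧ d a ∈ S ∧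
      c.den (i a) = i (d a) ∧ B (d a) ≤ B a ∧ m (d a) < m a))
    (base : Computes {a | a ∈ S ∧ κ.den (i a) = .leaf} i o B)
    (one : Computes {a | a ∈ S ∧ κ.den (i a) = .ofTag 1}
      (fun a ↦ .node (i a) (o (d a))) o B) : Computes S i o B := by
  have h2 : ∀ a, ¬ (a ∈ S ∧ κ.den (i a) = .ofTag 2) := by
    rintro a ⟨ha, h⟩
    rcases hcov a ha with h' | ⟨h', _⟩ <;> rw [h] at h' <;> simp [BTree.ofTag] at h'
  refine recur m κ c .nil hκ hc rfl d id hs hm (fun a ha ↦ (hcov a ha).imp id .inl) base one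
    (.exp .nil rfl 0 ?_ ?_)
  · exact fun a ha ↦ (h2 a ha).elim
  · exact fun a ha ↦ (h2 a ha).elim

end Computes

/-! ### Binary arithmetic -/

theorem le_pow_of_le_mul {x b : ℕ} (c : ℕ) (h : x ≤ c * (b + 2)) : x ≤ (b + 2) ^ (c + 1) :=
  h.trans (const_mul_pow_le_pow (by simp))

theorem size_encBits_le (l : List Bool) : (encBits l).size ≤ 4 * l.length + 1 := by
  induction l with
  | nil => simp [encBits, BTree.size]
  | cons b l ih =>
    have := BTree.size_ofBool_le b
    simp only [encBits, BTree.size, List.length_cons]; omega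

theorem length_le_size_encBits (l : List Bool) : 2 * l.length + 1 ≤ (encBits l).size := by
  induction l with
  | nil => simp [encBits, BTree.size]
  | cons b l ih =>
    have := (BTree.ofBool b).one_le_size
    simp only [encBits, BTree.size, List.length_cons]; omega

/-- The number with the given binary digits, least significant digit first. -/
def bitsVal : List Bool → ℕ
  | [] => 0
  | b :: l => b.toNat + 2 * bitsVal l

theorem bitsVal_bits (n : ℕ) : bitsVal n.bits = n := by
  induction n using Nat.binaryRec' with
  | zero => simp [bitsVal]
  | bit b n h ih => rw [Nat.bits_append_bit _ _ h, bitsVal, ih, Nat.bit_val]; ring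

/-- Binary successor. -/
def succBits : List Bool → List Bool
  | [] => [true]
  | false :: l => true :: l
  | true :: l => false :: succBits l

theorem bitsVal_succBits (l : List Bool) : bitsVal (succBits l) = bitsVal l + 1 := by
  induction l with
  | nil => rfl
  | cons b l ih => cases b <;> simp [succBits, bitsVal, ih]; omega; omega

theorem length_succBits_le (l : List Bool) : (succBits l).length ≤ l.length + 1 := by
  induction l with
  | nil => simp [succBits]
  | cons b l ih => cases b <;> simp [succBits]; exact ih

/-- Binary addition. -/
def addBits : List Bool → List Bool → List Bool
  | [], b => b
  | x :: a, [] => x :: a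
  | false :: a, y :: b => y :: addBits a b
  | true :: a, false :: b => true :: addBits a b
  | true :: a, true :: b => false :: succBits (addBits a b)

theorem bitsVal_addBits (a b : List Bool) : bitsVal (addBits a b) = bitsVal a + bitsVal b := by
  induction a generalizing b with
  | nil => simp [addBits, bitsVal]
  | cons x a ih =>
    cases b with
    | nil => simp [addBits, bitsVal]
    | cons y b =>
      cases x <;> cases y <;> simp [addBits, bitsVal, ih, bitsVal_succBits] <;> omega

theorem length_addBits_le (a b : List Bool) :
    (addBits a b).length ≤ a.length + b.length + 1 := by
  induction a generalizing b with
  | nil => simp [addBits]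
  | cons x a ih =>
    cases b with
    | nil => simp [addBits]
    | cons y b =>
      have := ih b
      have := length_succBits_le (addBits a b)
      cases x
      · simp only [addBits, List.length_cons]; omega
      · cases y <;> simp only [addBits, List.length_cons] <;> omega

/-- Binary multiplication. -/
def mulBits : List Bool → List Bool → List Bool
  | [], _ => []
  | x :: a, b => addBits (if x then b else []) (false :: mulBits a b)

theorem bitsVal_mulBits (a b : List Bool) : bitsVal (mulBits a b) = bitsVal a * bitsVal b := by
  induction a with
  | nil => simp [mulBits, bitsVal]
  | cons x a ih =>
    cases x <;> simp [mulBits, bitsVal, ih, bitsVal_addBits] <;> ring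

theorem length_mulBits_le (a b : List Bool) :
    (mulBits a b).length ≤ a.length * (b.length + 2) := by
  induction a with
  | nil => simp [mulBits]
  | cons x a ih =>
    have h := length_addBits_le (if x then b else []) (false :: mulBits a b)
    have h' : (if x then b else []).length ≤ b.length := by cases x <;> simp
    simp only [mulBits, List.length_cons, Nat.succ_mul] at h ⊢
    omega

/-- The comparison of two numbers with last digits `x` and `y` reduces to that of the remaining
digits, with this value in case of equality. -/
def ltStep (acc x y : Bool) : Bool := if x = y then acc else y

/-- Comparison of two binary numbers; for equal numbers the result is `acc`. -/
def ltBits : Bool → List Bool → List Bool → Bool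
  | acc, [], [] => acc
  | acc, [], y :: b => ltBits (ltStep acc false y) [] b
  | acc, x :: a, [] => ltBits (ltStep acc x false) a []
  | acc, x :: a, y :: b => ltBits (ltStep acc x y) a b
termination_by _ a b => a.length + b.length

theorem ltBits_iff (acc : Bool) (a b : List Bool) :
    ltBits acc a b = true ↔ bitsVal a < bitsVal b ∨ (bitsVal a = bitsVal b ∧ acc = true) := by
  induction acc, a, b using ltBits.induct with
  | case1 acc => simp [ltBits]
  | case2 acc y b ih =>
    rw [ltBits, ih]; cases y <;> cases acc <;> simp [bitsVal, ltStep] <;> omega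
  | case3 acc x a ih =>
    rw [ltBits, ih]; cases x <;> cases acc <;> simp [bitsVal, ltStep]
  | case4 acc x a y b ih =>
    rw [ltBits, ih]; cases x <;> cases y <;> cases acc <;> simp [bitsVal, ltStep] <;> omega

/-- The expression with value `true`. -/
abbrev Exp.tt : Exp := .cons .nil .nil

theorem computes_succBits : Computes Set.univ encBits (fun l ↦ encBits (succBits l))
    (fun l ↦ 4 * l.length + 9) := by
  refine .recur₁ List.length (.hd .arg) (.tl .arg) rfl rfl List.tail ?_ ?_ ?_
    (.exp (.cons .tt (.tl .arg)) rfl 1 ?_ ?_)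
    (.exp (.cons .nil (.tl .arg)) rfl 3 (fun l _ ↦ le_pow_of_le_mul 2 ?_) ?_)
  · intro l _
    have := size_encBits_le l
    omega
  · intro l _
    omega
  · rintro (_ | ⟨_ | _, l⟩) _
    · exact .inl rfl
    · exact .inl rfl
    · exact .inr ⟨rfl, trivial, rfl, by simp, by simp⟩
  · intro l _
    have := size_encBits_le l
    simp; omega
  · rintro (_ | ⟨_ | _, l⟩) ⟨_, h⟩
    · rfl
    · rfl
    · cases h
  · have := size_encBits_le l
    have := size_encBits_le (succBits l.tail)
    have := length_succBits_le l.tail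
    have := l.length_tail
    simp only [BTree.size]; omega
  · rintro (_ | ⟨_ | _, l⟩) ⟨_, h⟩
    · cases h
    · cases h
    · rfl

theorem computes_addBits : Computes Set.univ
    (fun p : List Bool × List Bool ↦ .node (encBits p.1) (encBits p.2))
    (fun p ↦ encBits (addBits p.1 p.2)) (fun p ↦ 4 * p.1.length + 4 * p.2.length + 9) := by
  have hs : ∀ p : List Bool × List Bool, (BTree.node (encBits p.1) (encBits p.2)).size ≤
      4 * p.1.length + 4 * p.2.length + 9 := by
    intro p
    have := size_encBits_le p.1
    have := size_encBits_le p.2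
    simp only [BTree.size]; omega
  have hs' : ∀ p : List Bool × List Bool,
      (addBits p.1.tail p.2.tail).length ≤ p.1.length + p.2.length + 1 := by
    intro p
    have := length_addBits_le p.1.tail p.2.tail
    have := p.1.length_tail
    have := p.2.length_tail
    omega
  refine .recur₁ (fun p ↦ p.1.length) (.ite (.hd .arg) (.ite (.tl .arg) .tt .nil) .nil)
    (.cons (.tl (.hd .arg)) (.tl (.tl .arg))) rfl rfl (fun p ↦ (p.1.tail, p.2.tail)) ?_ ?_ ?_
    (.exp (.ite (.hd .arg) (.hd .arg) (.tl .arg)) rfl 1 ?_ ?_) ?_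
  · exact fun p _ ↦ hs p
  · intro p _
    omega
  · rintro ⟨_ | ⟨x, a⟩, _ | ⟨y, b⟩⟩ _
    · exact .inl rfl
    · exact .inl rfl
    · exact .inl rfl
    · exact .inr ⟨rfl, trivial, rfl, by simp; omega, by simp⟩
  · intro p _
    have := hs p
    simp; omega
  · rintro ⟨_ | ⟨x, a⟩, _ | ⟨y, b⟩⟩ ⟨_, h⟩
    · rfl
    · rfl
    · rfl
    · cases h
  · have hs₁ : ∀ p : List Bool × List Bool, (BTree.node (.node (encBits p.1) (encBits p.2))
        (encBits (addBits p.1.tail p.2.tail))).size ≤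
          2 * (4 * p.1.length + 4 * p.2.length + 9 + 2) := by
      intro p
      have := hs p
      have := size_encBits_le (addBits p.1.tail p.2.tail)
      have := hs' p
      rw [BTree.size]; omega
    -- the last digits of the summands decide whether the sum of the others needs a carry
    refine ((Computes.exp .arg rfl 3 (fun p _ ↦ le_pow_of_le_mul 2 (hs₁ p))
      (fun _ _ ↦ rfl)).pair ((Computes.exp (.tl .arg) rfl 3
        (fun p _ ↦ le_pow_of_le_mul 2 (hs₁ p)) (fun _ _ ↦ rfl)).comp computes_succBits
        (fun p ↦ addBits p.1.tail p.2.tail) 3 (fun _ _ ↦ trivial) (fun _ _ ↦ rfl)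
        (fun p _ ↦ le_pow_of_le_mul 2 ?_))).andThen
      (.ite (.hd (.hd (.hd (.hd .arg))))
        (.ite (.hd (.tl (.hd (.hd .arg)))) (.cons .nil (.tl .arg))
          (.cons .tt (.tl (.hd .arg))))
        (.cons (.hd (.tl (.hd (.hd .arg)))) (.tl (.hd .arg)))) rfl ?_
    · have := hs' p
      omega
    · rintro ⟨_ | ⟨_ | _, a⟩, _ | ⟨_ | _, b⟩⟩ ⟨_, h⟩ <;> first | rfl | cases h

theorem computes_mulBits : Computes Set.univ
    (fun p : List Bool × List Bool ↦ .node (encBits p.1) (encBits p.2))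
    (fun p ↦ encBits (mulBits p.1 p.2))
    (fun p ↦ 4 * ((p.1.length + 1) * (p.2.length + 2)) + 1) := by
  have hs : ∀ p : List Bool × List Bool, (BTree.node (encBits p.1) (encBits p.2)).size ≤
      4 * ((p.1.length + 1) * (p.2.length + 2)) + 1 := by
    intro p
    have := size_encBits_le p.1
    have := size_encBits_le p.2
    have : p.1.length * 1 ≤ p.1.length * (p.2.length + 2) := Nat.mul_le_mul_left _ (by omega)
    simp only [BTree.size, Nat.succ_mul]; omega
  have hs' : ∀ p : List Bool × List Bool, (mulBits p.1.tail p.2).length ≤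
      p.1.length * (p.2.length + 2) := by
    intro p
    refine (length_mulBits_le p.1.tail p.2).trans (Nat.mul_le_mul_right _ ?_)
    have := p.1.length_tail
    omega
  refine .recur₁ (fun p ↦ p.1.length) (.ite (.hd .arg) .tt .nil)
    (.cons (.tl (.hd .arg)) (.tl .arg)) rfl rfl (fun p ↦ (p.1.tail, p.2)) ?_ ?_ ?_
    (.exp .nil rfl 1 ?_ ?_) ?_
  · exact fun p _ ↦ hs p
  · intro p _
    have : p.1.length * 1 ≤ p.1.length * (p.2.length + 2) := Nat.mul_le_mul_left _ (by omega)
    simp only [Nat.succ_mul]; omega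
  · rintro ⟨_ | ⟨x, a⟩, b⟩ _
    · exact .inl rfl
    · refine .inr ⟨rfl, trivial, rfl, ?_, by simp⟩
      simp only [List.tail_cons, List.length_cons, Nat.succ_mul]; omega
  · intro p _
    have := hs p
    simp; omega
  · rintro ⟨_ | ⟨x, a⟩, b⟩ ⟨_, h⟩
    · rfl
    · cases h
  · refine (Computes.exp (.cons (.ite (.hd (.hd (.hd .arg))) (.tl (.hd .arg)) .nil)
        (.cons .nil (.tl .arg))) rfl 3 (fun p _ ↦ le_pow_of_le_mul 2 ?_)
        (o := fun p ↦ .node (encBits (if p.1.headD false then p.2 else []))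
          (encBits (false :: mulBits p.1.tail p.2))) ?_).comp computes_addBits
        (fun p ↦ (if p.1.headD false then p.2 else [], false :: mulBits p.1.tail p.2)) 5
        (fun _ _ ↦ trivial) (fun _ _ ↦ rfl) (fun p _ ↦ le_pow_of_le_mul 4 ?_)
        |>.congr (fun _ _ ↦ rfl) ?_
    · have := hs p
      have := size_encBits_le (mulBits p.1.tail p.2)
      have := hs' p
      rw [BTree.size]
      simp only [Nat.succ_mul] at *
      omega
    · rintro ⟨_ | ⟨_ | _, a⟩, b⟩ ⟨_, h⟩ <;> rfl
    · have h1 := hs' p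
      have h2 : (if p.1.headD false then p.2 else []).length ≤ p.2.length := by
        split <;> simp
      simp only [List.length_cons, Nat.succ_mul] at *
      omega
    · rintro ⟨_ | ⟨_ | _, a⟩, b⟩ ⟨_, h⟩ <;> first | rfl | cases h

theorem computes_ltBits : Computes Set.univ
    (fun p : Bool × List Bool × List Bool ↦
      .node (.ofBool p.1) (.node (encBits p.2.1) (encBits p.2.2)))
    (fun p ↦ .ofBool (ltBits p.1 p.2.1 p.2.2))
    (fun p ↦ 4 * p.2.1.length + 4 * p.2.2.length + 9) := by
  have hs : ∀ p : Bool × List Bool × List Bool,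
      (BTree.node (.ofBool p.1) (.node (encBits p.2.1) (encBits p.2.2))).size ≤
        4 * p.2.1.length + 4 * p.2.2.length + 9 := by
    intro p
    have := size_encBits_le p.2.1
    have := size_encBits_le p.2.2
    have := BTree.size_ofBool_le p.1
    simp only [BTree.size]; omega
  refine .recur₁ (fun p ↦ p.2.1.length + p.2.2.length)
    (.ite (.hd (.tl .arg)) .tt (.ite (.tl (.tl .arg)) .tt .nil))
    (.cons (.ite (.equal (.hd (.hd (.tl .arg))) (.hd (.tl (.tl .arg)))) (.hd .arg)
      (.hd (.tl (.tl .arg)))) (.cons (.tl (.hd (.tl .arg))) (.tl (.tl (.tl .arg))))) rfl rfl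
    (fun p ↦ (ltStep p.1 (p.2.1.headD false) (p.2.2.headD false), p.2.1.tail, p.2.2.tail))
    ?_ ?_ ?_ (.exp (.hd .arg) rfl 1 ?_ ?_) (.exp (.tl .arg) rfl 3 ?_ ?_)
  · exact fun p _ ↦ hs p
  · intro p _
    omega
  · rintro ⟨c, _ | ⟨x, a⟩, _ | ⟨y, b⟩⟩ _
    · exact .inl rfl
    · exact .inr ⟨rfl, trivial, by cases y <;> rfl, by simp, by simp⟩
    · exact .inr ⟨rfl, trivial, by cases x <;> rfl, by simp, by simp⟩
    · exact .inr ⟨rfl, trivial, by cases x <;> cases y <;> rfl, by simp; omega, by simp; omega⟩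
  · intro p _
    have := hs p
    simp; omega
  · rintro ⟨c, _ | ⟨x, a⟩, _ | ⟨y, b⟩⟩ ⟨_, h⟩
    · simp [ltBits, Exp.den, BTree.head]
    · cases h
    · cases h
    · cases h
  · intro p _
    refine le_pow_of_le_mul 2 ?_
    have := hs p
    have := BTree.size_ofBool_le (ltBits
      (ltStep p.1 (p.2.1.headD false) (p.2.2.headD false)) p.2.1.tail p.2.2.tail)
    rw [BTree.size]
    dsimp only
    omega
  · rintro ⟨c, _ | ⟨x, a⟩, _ | ⟨y, b⟩⟩ ⟨_, h⟩
    · cases h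
    · simp [ltBits, Exp.den, BTree.tail]
    · simp [ltBits, Exp.den, BTree.tail]
    · simp [ltBits, Exp.den, BTree.tail]

/-- The order of rational numbers, by their signs and by cross multiplication. -/
theorem rat_lt_iff_bits (q r : ℚ) : q < r ↔
    if q < 0 then (if r < 0 then
        bitsVal (mulBits r.num.natAbs.bits q.den.bits) <
          bitsVal (mulBits q.num.natAbs.bits r.den.bits)
      else True)
    else (if r < 0 then False
      else bitsVal (mulBits q.num.natAbs.bits r.den.bits) <
          bitsVal (mulBits r.num.natAbs.bits q.den.bits)) := by
  simp only [bitsVal_mulBits, bitsVal_bits]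
  split_ifs with hq hr hr
  · rw [Rat.lt_iff]
    have h1 := Rat.num_neg.2 hq
    have h2 := Rat.num_neg.2 hr
    zify
    rw [abs_of_neg h1, abs_of_neg h2]
    constructor <;> intro h <;> linarith
  · simp only [iff_true]; linarith
  · simp only [iff_false]; linarith
  · rw [Rat.lt_iff]
    have h1 := Rat.num_nonneg.2 (not_lt.1 hq)
    have h2 := Rat.num_nonneg.2 (not_lt.1 hr)
    zify
    rw [abs_of_nonneg h1, abs_of_nonneg h2]

theorem length_bits_le_size_encRat (q : ℚ) :
    q.num.natAbs.bits.length + q.den.bits.length ≤ (encRat q).size := by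
  have h1 := length_le_size_encBits q.num.natAbs.bits
  have h2 := length_le_size_encBits q.den.bits
  simp only [encRat, encNat, BTree.size]; omega

theorem computes_ratLt : Computes Set.univ
    (fun p : ℚ × ℚ ↦ .node (encRat p.1) (encRat p.2))
    (fun p ↦ .ofBool (decide (p.1 < p.2)))
    (fun p ↦ (BTree.node (encRat p.1) (encRat p.2)).size) := by
  let X : ℚ × ℚ → List Bool := fun p ↦ mulBits p.1.num.natAbs.bits p.2.den.bits
  let Y : ℚ × ℚ → List Bool := fun p ↦ mulBits p.2.num.natAbs.bits p.1.den.bits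
  have hlen : ∀ q r : ℚ, (q.num.natAbs.bits.length + 1) * (r.den.bits.length + 2) ≤
      ((BTree.node (encRat q) (encRat r)).size + 2) ^ 2 := by
    intro q r
    have := length_bits_le_size_encRat q
    have := length_bits_le_size_encRat r
    rw [sq]
    apply Nat.mul_le_mul <;> simp only [BTree.size] <;> omega
  have hsz : ∀ q r : ℚ, (BTree.node (encRat q) (encRat r)).size =
      (BTree.node (encRat r) (encRat q)).size := by
    intro q r; simp only [BTree.size]; omega
  have hmul : ∀ q r : ℚ, (mulBits q.num.natAbs.bits r.den.bits).length ≤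
      ((BTree.node (encRat q) (encRat r)).size + 2) ^ 2 := by
    intro q r
    refine ((length_mulBits_le _ _).trans ?_).trans (hlen q r)
    exact Nat.mul_le_mul_right _ (by omega)
  have hmulB : ∀ q r : ℚ, 4 * ((q.num.natAbs.bits.length + 1) * (r.den.bits.length + 2)) + 1 ≤
      ((BTree.node (encRat q) (encRat r)).size + 2) ^ (4 + 2 + 0 + 2) := by
    intro q r
    have := add_pow_le_pow (const_mul_pow_le_pow (c := 4) (hlen q r)) (t := 1) (l := 0) (by simp)
    omega
  let I : ℚ × ℚ → BTree := fun p ↦ .node (encRat p.1) (encRat p.2)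
  have hI : ∀ e : Exp, e.callFree = true →
      Computes Set.univ I (fun p ↦ e.den (I p)) (fun p ↦ (I p).size) :=
    fun e he ↦ .exp e he 1 (fun p _ ↦ by simp) (fun _ _ ↦ rfl)
  have hX : Computes Set.univ I (fun p ↦ encBits (X p)) (fun p ↦ (I p).size) :=
    (hI (.cons (.hd (.tl (.hd .arg))) (.tl (.tl (.tl .arg)))) rfl).comp computes_mulBits
      (fun p ↦ (p.1.num.natAbs.bits, p.2.den.bits)) _ (fun _ _ ↦ trivial) (fun _ _ ↦ rfl)
      (fun p _ ↦ hmulB p.1 p.2)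
  have hY : Computes Set.univ I (fun p ↦ encBits (Y p)) (fun p ↦ (I p).size) :=
    (hI (.cons (.hd (.tl (.tl .arg))) (.tl (.tl (.hd .arg)))) rfl).comp computes_mulBits
      (fun p ↦ (p.2.num.natAbs.bits, p.1.den.bits)) _ (fun _ _ ↦ trivial) (fun _ _ ↦ rfl)
      (fun p _ ↦ by simpa only [I, hsz p.1 p.2] using hmulB p.2 p.1)
  have hB : ∀ p : ℚ × ℚ, 4 * (X p).length + 4 * (Y p).length + 9 ≤
      ((I p).size + 2) ^ (17 + 2) := by
    intro p
    have h1 := hmul p.1 p.2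
    have h2 := hmul p.2 p.1
    rw [hsz p.2 p.1] at h2
    have h3 : 1 ≤ ((I p).size + 2) ^ 2 := Nat.one_le_pow _ _ (by omega)
    refine le_trans ?_ (const_mul_pow_le_pow (c := 17) (le_refl (((I p).size + 2) ^ 2)))
    simp only [X, Y, I] at *
    omega
  have hXY : Computes Set.univ I (fun p ↦ .ofBool (ltBits false (X p) (Y p)))
      (fun p ↦ (I p).size) :=
    ((hI .nil rfl).pair (hX.pair hY)).comp
      computes_ltBits (fun p ↦ (false, X p, Y p)) _ (fun _ _ ↦ trivial) (fun _ _ ↦ rfl)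
      (fun p _ ↦ hB p)
  have hYX : Computes Set.univ I (fun p ↦ .ofBool (ltBits false (Y p) (X p)))
      (fun p ↦ (I p).size) :=
    ((hI .nil rfl).pair (hY.pair hX)).comp
      computes_ltBits (fun p ↦ (false, Y p, X p)) _ (fun _ _ ↦ trivial) (fun _ _ ↦ rfl)
      (fun p _ ↦ (by rw [add_comm (4 * _)]; exact hB p))
  refine ((hI .arg rfl).pair (hXY.pair hYX)).andThen
    (.ite (.hd (.hd (.hd .arg)))
      (.ite (.hd (.tl (.hd .arg))) (.tl (.tl .arg)) .tt)
      (.ite (.hd (.tl (.hd .arg))) .nil (.hd (.tl .arg)))) rfl ?_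
  rintro ⟨q, r⟩ _
  have h1 : decide (q < r) = if q < 0 then (if r < 0 then ltBits false (Y (q, r)) (X (q, r))
      else true) else (if r < 0 then false else ltBits false (X (q, r)) (Y (q, r))) := by
    rw [Bool.eq_iff_iff, decide_eq_true_iff, rat_lt_iff_bits]
    split_ifs <;> simp [ltBits_iff, X, Y]
  by_cases hq : q < 0 <;> by_cases hr : r < 0 <;>
    simp only [h1, hq, hr, if_true, if_false, Exp.den, encRat, BTree.head, BTree.tail, decide_true,
      decide_false, BTree.ofBool, BTree.cond, I]

attribute [simp] BTree.ofTag BTree.size Exp.den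

namespace BTree

@[simp] theorem head_node (l r : BTree) : (node l r).head = l := rfl

@[simp] theorem head_leaf : leaf.head = leaf := rfl

@[simp] theorem tail_node (l r : BTree) : (node l r).tail = r := rfl

@[simp] theorem ofBool_true : ofBool true = node leaf leaf := rfl

@[simp] theorem ofBool_false : ofBool false = leaf := rfl

@[simp] theorem cond_node (l r x y : BTree) : (node l r).cond x y = x := rfl

@[simp] theorem cond_leaf (x y : BTree) : leaf.cond x y = y := rfl

end BTree

/-! ### Encodings are injective -/

theorem ofBool_inj {a b : Bool} : BTree.ofBool a = BTree.ofBool b ↔ a = b := by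
  cases a <;> cases b <;> simp

theorem encBits_inj {l m : List Bool} : encBits l = encBits m ↔ l = m := by
  induction l generalizing m with
  | nil => cases m <;> simp [encBits]
  | cons a l ih => cases m <;> simp [encBits, ih, ofBool_inj]

theorem encNat_inj {m n : ℕ} : encNat m = encNat n ↔ m = n := by
  rw [encNat, encNat, encBits_inj]
  exact ⟨fun h ↦ by rw [← bitsVal_bits m, h, bitsVal_bits], fun h ↦ h ▸ rfl⟩

theorem encRat_inj {q r : ℚ} : encRat q = encRat r ↔ q = r := by
  refine ⟨fun h ↦ ?_, fun h ↦ h ▸ rfl⟩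
  simp only [encRat, BTree.node.injEq, encNat_inj, ofBool_inj, decide_eq_decide] at h
  obtain ⟨h1, h2, h3⟩ := h
  rw [← Rat.num_neg, ← Rat.num_neg] at h1
  exact Rat.ext (by omega) h3

theorem Var.enc_inj {v w : Var} : v.enc = w.enc ↔ v = w := by
  cases v <;> cases w <;> simp [Var.enc, encNat_inj]

/-! ### Formulas with abstract terms -/

/-- The terms of the formulas that the quantifier elimination works on: variables, the attributes
of a third tuple, and constants of the two domains. -/
inductive Term : Type
  | var (v : Var)
  | third (i : ℕ)
  | cst (c : Const)
  | rat (q : ℚ)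
  deriving DecidableEq

/-- The left component tells apart the constants of the two domains and the remaining terms. The
latter are tagged as variables are, with the attributes of the third tuple as a fourth kind. -/
def Term.enc : Term → BTree
  | var v => .node .leaf v.enc
  | third i => .node .leaf (.node (.ofTag 3) (encNat i))
  | cst c => .node (.ofTag 1) (encBits c)
  | rat q => .node (.ofTag 2) (encRat q)

theorem Term.enc_inj {s t : Term} : s.enc = t.enc ↔ s = t := by
  cases s <;> cases t <;> simp [Term.enc, Var.enc_inj, encNat_inj, encBits_inj, encRat_inj]
  · rename_i v _; cases v <;> simp [Var.enc]
  · rename_i v; cases v <;> simp [Var.enc]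

/-- Formulas over abstract terms. The sort `false` is `𝒟`, and `true` is `𝒬`. Atoms of sort
`false` are equations `s = t`, atoms of sort `true` are inequalities `s < t`. Every term can be
quantified. -/
inductive Fm : Type
  | fls
  | atm (k : Bool) (s t : Term)
  | imp (φ ψ : Fm)
  | ex (k : Bool) (x : Term) (φ : Fm)

namespace Fm

/-- The tag of a formula is the number of its direct subformulas, and the first one of these is
found at the same place in implications and in quantified formulas. -/
def enc : Fm → BTree
  | fls => .leaf
  | atm k s t => .node .leaf (.node (.ofBool k) (.node s.enc t.enc))
  | imp φ ψ => .node (.ofTag 2) (.node φ.enc ψ.enc)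
  | ex k x φ => .node (.ofTag 1) (.node φ.enc (.node (.ofBool k) x.enc))

/-- The first direct subformula. -/
def kid₁ : Fm → Fm
  | imp φ _ => φ
  | ex _ _ φ => φ
  | _ => fls

/-- The second direct subformula. -/
def kid₂ : Fm → Fm
  | imp _ ψ => ψ
  | _ => fls

/-- The quantified term, with a junk value for formulas that do not begin with a quantifier. -/
def qvar : Fm → Term
  | ex _ x _ => x
  | _ => .third 0

/-- Negation. -/
abbrev neg (φ : Fm) : Fm := imp φ fls

/-- Truth. -/
abbrev tru : Fm := imp fls fls

/-- Disjunction. -/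
abbrev disj (φ ψ : Fm) : Fm := imp φ.neg ψ

/-- The free terms of sort `k`, constants included. -/
def fv (k : Bool) : Fm → List Term
  | fls => []
  | atm k' s t => if k' = k then [s, t] else []
  | imp φ ψ => φ.fv k ++ ψ.fv k
  | ex k' x φ => if k' = k then (φ.fv k).filter (· ≠ x) else φ.fv k

end Fm

/-- The points at which an existentially quantified formula is tested: a point below all values, a
point immediately above the value of `t`, and the value of `t`. In the sort `𝒟`, whose atoms only
test equality, each of the first two acts as a value that is different from those of all terms. -/
inductive Point : Type
  | inf
  | plus (t : Term)
  | exact (t : Term)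

namespace Point

/-- Test points as trees, with the cases distinguished by the left component. -/
def enc : Point → BTree
  | inf => .leaf
  | plus t => .node .leaf t.enc
  | exact t => .node (.ofTag 1) t.enc

/-- The statement that `s` is below the point. -/
def low (s : Term) : Point → Fm
  | inf => .fls
  | plus t => .neg (.atm true t s)
  | exact t => .atm true s t

/-- The statement that `s` is above the point. -/
def up (s : Term) : Point → Fm
  | inf => .tru
  | plus t => .atm true t s
  | exact t => .atm true t s

/-- The statement that `s` is at the point, in the sort `𝒟`. -/
def same (s : Term) : Point → Fm
  | inf => .fls
  | plus _ => .fls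
  | exact t => .atm false s t

/-- The atom `s = t` or `s < t` with the point substituted for `x`. -/
def subAtm (x : Term) (μ : Point) (s t : Term) : Bool → Fm
  | true => if s = x then if t = x then .fls else μ.up t else
      if t = x then μ.low s else .atm true s t
  | false => if s = x then if t = x then .tru else μ.same t else
      if t = x then μ.same s else .atm false s t

end Point

namespace Fm

/-- Virtual substitution of a point for the term `x` of sort `k` in a quantifier-free formula. -/
def sub (k : Bool) (x : Term) (μ : Point) : Fm → Fm
  | fls => fls
  | atm k' s t => if k' = k then μ.subAtm x s t k' else atm k' s t
  | imp φ ψ => imp (φ.sub k x μ) (ψ.sub k x μ)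
  | ex k' y φ => ex k' y (φ.sub k x μ)

/-- Elimination of `∃ x` from `∃ x, φ` by testing the points that belong to the terms in a list. -/
def elim (k : Bool) (x : Term) (φ : Fm) : List Term → Fm
  | [] => φ.sub k x .inf
  | t :: T => disj (φ.sub k x (.exact t)) (disj (φ.sub k x (.plus t)) (elim k x φ T))

/-- Quantifier elimination. The terms for the test points are taken from the given formula, and
not from the formula of exponential size from which the quantifier is eliminated. -/
def qe : Fm → Fm
  | fls => fls
  | atm k s t => atm k s t
  | imp φ ψ => imp φ.qe ψ.qe
  | ex k x φ => elim k x φ.qe (fv k (ex k x φ))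

end Fm

/-- The attributes of the third tuple. -/
def Term.isThird : Term → Bool
  | third _ => true
  | _ => false

/-- Quantification over the attributes of the third tuple that are in the list. -/
def Fm.exs (k : Bool) (φ : Fm) : List Term → Fm
  | [] => φ
  | t :: L => if t.isThird then .ex k t (exs k φ L) else exs k φ L

/-- Renaming of the variables of `C(t₁, t₂)`: the result is `C(t₁, t₃)` or `C(t₂, t₃)`. -/
def ren (b : Bool) : Var → Term
  | .left i => .var (if b then .right i else .left i)
  | .right i => .third i
  | .bound n => .var (.bound n)

/-- Equality constraints between terms. -/
def eqFm (s t : Term) : EqRel → Fm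
  | .eq => .atm false s t
  | .ne => .neg (.atm false s t)

/-- Rational-order constraints between terms, expressed by `<`. -/
def ordFm (s t : Term) : OrdRel → Fm
  | .eq => .neg (.disj (.atm true s t) (.atm true t s))
  | .ne => .disj (.atm true s t) (.atm true t s)
  | .lt => .atm true s t
  | .gt => .atm true t s
  | .le => .neg (.atm true t s)
  | .ge => .neg (.atm true s t)

/-- Translation of ERO formulas, with a renaming of the variables. -/
def ERO.trans (b : Bool) : ERO → Fm
  | fls => .fls
  | eqVar r x y => eqFm (ren b x) (ren b y) r
  | eqConst r x c => eqFm (ren b x) (.cst c) r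
  | ordVar r x y => ordFm (ren b x) (ren b y) r
  | ordConst r x c => ordFm (ren b x) (.rat c) r
  | not φ => .neg (φ.trans b)
  | and φ ψ => .neg (.imp (φ.trans b) (.neg (ψ.trans b)))
  | or φ ψ => .disj (φ.trans b) (ψ.trans b)
  | exD n φ => .ex false (.var (.bound n)) (φ.trans b)
  | exQ n φ => .ex true (.var (.bound n)) (φ.trans b)
  | allD n φ => .neg (.ex false (.var (.bound n)) (.neg (φ.trans b)))
  | allQ n φ => .neg (.ex true (.var (.bound n)) (.neg (φ.trans b)))

/-- The formula `C(t₁, t₃) ∧ ¬ C(t₂, t₃)`. -/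
def ERO.matrix (φ : ERO) : Fm := .neg (.imp (φ.trans false) (φ.trans true))

/-- The formula `∃ t₃, C(t₁, t₃) ∧ ¬ C(t₂, t₃)`, which defines a weak order extension. -/
def ERO.extFm (φ : ERO) : Fm :=
  .exs true (.exs false φ.matrix (φ.matrix.fv false)) (φ.matrix.fv true)

/-- The terms that occur in ERO formulas in positions of sort `k`. -/
def Term.HasSort : Bool → Term → Prop
  | _, var _ => True
  | false, cst _ => True
  | true, rat _ => True
  | _, _ => False

/-- Quantifier-free formulas whose terms are those of ERO formulas. -/
def Fm.Plain : Fm → Prop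
  | fls => True
  | atm k s t => s.HasSort k ∧ t.HasSort k
  | imp φ ψ => φ.Plain ∧ ψ.Plain
  | ex _ _ _ => False

/-- The ERO formula for an atom. Atoms without variables are evaluated. -/
def atmERO : Bool → Term → Term → ERO
  | true, .var x, .var y => .ordVar .lt x y
  | true, .var x, .rat c => .ordConst .lt x c
  | true, .rat c, .var x => .ordConst .gt x c
  | true, .rat c, .rat c' => if c < c' then .not .fls else .fls
  | false, .var x, .var y => .eqVar .eq x y
  | false, .var x, .cst c => .eqConst .eq x c
  | false, .cst c, .var x => .eqConst .eq x c
  | false, .cst c, .cst c' => if c = c' then .not .fls else .fls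
  | _, _, _ => .fls

/-- Translation of plain formulas into ERO formulas. -/
def Fm.toERO : Fm → ERO
  | fls => .fls
  | atm k s t => atmERO k s t
  | imp φ ψ => .or (.not φ.toERO) ψ.toERO
  | ex _ _ _ => .fls

/-! ### Programs for the operations on formulas -/

/-- Lists of terms as trees. -/
def encTerms : List Term → BTree
  | [] => .leaf
  | t :: L => .node t.enc (encTerms L)

theorem size_encTerms_append (L M : List Term) :
    (encTerms (L ++ M)).size + 1 = (encTerms L).size + (encTerms M).size := by
  induction L with
  | nil => simp [encTerms]; omega
  | cons t L ih => simp only [List.cons_append, encTerms, BTree.size]; omega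

theorem size_encTerms_filter_le (p : Term → Bool) (L : List Term) :
    (encTerms (L.filter p)).size ≤ (encTerms L).size := by
  induction L with
  | nil => simp [encTerms]
  | cons t L ih =>
    simp only [List.filter_cons]
    split <;> simp only [encTerms, BTree.size] <;> omega

theorem size_encTerms_tail_le (L : List Term) :
    (encTerms L.tail).size ≤ (encTerms L).size := by
  cases L <;> simp only [List.tail, encTerms, BTree.size] <;> omega

theorem computes_append : Computes Set.univ
    (fun p : List Term × List Term ↦ .node (encTerms p.1) (encTerms p.2))
    (fun p ↦ encTerms (p.1 ++ p.2))
    (fun p ↦ (BTree.node (encTerms p.1) (encTerms p.2)).size) := by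
  refine .recur₁ (fun p ↦ (encTerms p.1).size) (.ite (.hd .arg) .tt .nil)
    (.cons (.tl (.hd .arg)) (.tl .arg)) rfl rfl (fun p ↦ (p.1.tail, p.2)) (fun _ _ ↦ le_rfl)
    (fun p _ ↦ by simp only [BTree.size]; omega) ?_
    (.exp (.tl .arg) rfl 1 (fun p _ ↦ by simp) ?_)
    (.exp (.cons (.hd (.hd (.hd .arg))) (.tl .arg)) rfl 3 (fun p _ ↦ le_pow_of_le_mul 2 ?_) ?_)
  · rintro ⟨_ | ⟨t, L⟩, M⟩ _
    · exact .inl rfl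
    · exact .inr ⟨rfl, trivial, rfl, by simp [encTerms]; omega, by simp [encTerms]⟩
  · rintro ⟨_ | ⟨t, L⟩, M⟩ ⟨_, h⟩
    · rfl
    · cases h
  · have := size_encTerms_append p.1.tail p.2
    have := size_encTerms_tail_le p.1
    simp only [BTree.size]; omega
  · rintro ⟨_ | ⟨t, L⟩, M⟩ ⟨_, h⟩
    · cases h
    · rfl

theorem computes_filter : Computes Set.univ
    (fun p : Term × List Term ↦ .node p.1.enc (encTerms p.2))
    (fun p ↦ encTerms (p.2.filter (· ≠ p.1)))
    (fun p ↦ (BTree.node p.1.enc (encTerms p.2)).size) := by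
  refine .recur₁ (fun p ↦ (encTerms p.2).size) (.ite (.tl .arg) .tt .nil)
    (.cons (.hd .arg) (.tl (.tl .arg))) rfl rfl (fun p ↦ (p.1, p.2.tail)) (fun _ _ ↦ le_rfl)
    (fun p _ ↦ by simp only [BTree.size]; omega) ?_
    (.exp .nil rfl 1 (fun p _ ↦ by simp) ?_)
    (.exp (.ite (.equal (.hd (.tl (.hd .arg))) (.hd (.hd .arg))) (.tl .arg)
      (.cons (.hd (.tl (.hd .arg))) (.tl .arg))) rfl 3 (fun p _ ↦ le_pow_of_le_mul 2 ?_) ?_)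
  · rintro ⟨x, _ | ⟨t, L⟩⟩ _
    · exact .inl rfl
    · exact .inr ⟨rfl, trivial, rfl, by simp [encTerms]; omega, by simp [encTerms]⟩
  · rintro ⟨x, _ | ⟨t, L⟩⟩ ⟨_, h⟩
    · rfl
    · cases h
  · have := size_encTerms_filter_le (· ≠ p.1) p.2.tail
    have := size_encTerms_tail_le p.2
    simp only [BTree.size]; omega
  · rintro ⟨x, _ | ⟨t, L⟩⟩ ⟨_, h⟩
    · cases h
    · by_cases h : t = x <;> simp [encTerms, Term.enc_inj, h]

theorem size_encTerms_fv_le (k : Bool) (φ : Fm) : (encTerms (φ.fv k)).size ≤ φ.enc.size := by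
  induction φ with
  | fls => simp [Fm.fv, encTerms, Fm.enc]
  | atm k' s t =>
    have := (BTree.ofBool k').one_le_size
    simp only [Fm.fv]
    split <;> simp only [encTerms, Fm.enc, BTree.size] <;> omega
  | imp φ ψ ih₁ ih₂ =>
    have := size_encTerms_append (φ.fv k) (ψ.fv k)
    simp only [Fm.fv, Fm.enc, BTree.size]; omega
  | ex k' x φ ih =>
    have := size_encTerms_filter_le (· ≠ x) (φ.fv k)
    simp only [Fm.fv]
    split <;> simp only [Fm.enc, BTree.size] <;> omega

theorem Fm.size_kid₁_le (φ : Fm) : φ.kid₁.enc.size ≤ φ.enc.size := by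
  cases φ <;> simp [kid₁, enc] <;> omega

theorem Fm.size_kid₂_le (φ : Fm) : φ.kid₂.enc.size ≤ φ.enc.size := by
  cases φ <;> simp [kid₂, enc]; omega

theorem computes_fv : Computes Set.univ
    (fun p : Bool × Fm ↦ .node (.ofBool p.1) p.2.enc)
    (fun p ↦ encTerms (p.2.fv p.1))
    (fun p ↦ (BTree.node (.ofBool p.1) p.2.enc).size) := by
  have hs₁ : ∀ p : Bool × Fm, (encTerms (p.2.kid₁.fv p.1)).size ≤ p.2.enc.size := fun p ↦
    (size_encTerms_fv_le _ _).trans (Fm.size_kid₁_le _)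
  have hs₂ : ∀ p : Bool × Fm, (encTerms (p.2.kid₂.fv p.1)).size ≤ p.2.enc.size := fun p ↦
    (size_encTerms_fv_le _ _).trans (Fm.size_kid₂_le _)
  refine .recur (fun p ↦ p.2.enc.size) (.hd (.tl .arg))
    (.cons (.hd .arg) (.hd (.tl (.tl .arg)))) (.cons (.hd .arg) (.tl (.tl (.tl .arg))))
    rfl rfl rfl (fun p ↦ (p.1, p.2.kid₁)) (fun p ↦ (p.1, p.2.kid₂)) (fun _ _ ↦ le_rfl)
    (fun p _ ↦ by simp only [BTree.size]; omega) ?_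
    (.exp (.ite (.tl .arg) (.ite (.equal (.hd (.tl (.tl .arg))) (.hd .arg))
      (.cons (.hd (.tl (.tl (.tl .arg)))) (.cons (.tl (.tl (.tl (.tl .arg)))) .nil)) .nil) .nil)
      rfl 1 (fun p _ ↦ by simp) ?_) ?_ ?_
  · rintro ⟨k, φ⟩ _
    cases φ with
    | fls => exact .inl rfl
    | atm => exact .inl rfl
    | ex k' x φ =>
      exact .inr (.inl ⟨rfl, trivial, rfl, by simp [Fm.kid₁, Fm.enc]; omega,
        by simp [Fm.kid₁, Fm.enc]; omega⟩)
    | imp φ ψ =>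
      exact .inr (.inr ⟨rfl, trivial, rfl, by simp [Fm.kid₁, Fm.enc]; omega, trivial, rfl,
        by simp [Fm.kid₂, Fm.enc]; omega, by simp [Fm.kid₁, Fm.kid₂, Fm.enc]; omega⟩)
  · rintro ⟨k, φ⟩ ⟨_, h⟩
    cases φ with
    | fls => rfl
    | atm k' s t => by_cases hk : k' = k <;> simp [Fm.enc, Fm.fv, encTerms, ofBool_inj, hk]
    | ex => cases h
    | imp => cases h
  · have hs₃ : ∀ p : Bool × Fm, (BTree.node (.node (.ofBool p.1) p.2.enc)
        (encTerms (p.2.kid₁.fv p.1))).size ≤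
          2 * ((BTree.node (.ofBool p.1) p.2.enc).size + 2) := fun p ↦ by
      have := hs₁ p
      simp only [BTree.size]; omega
    refine .ite (.equal (.hd (.tl (.tl (.tl (.hd .arg))))) (.hd (.hd .arg))) rfl 3
      (fun p _ ↦ le_pow_of_le_mul 2 (hs₃ p)) ?_ (.exp (.tl .arg) rfl 3
        (fun p _ ↦ le_pow_of_le_mul 2 (hs₃ p)) ?_)
    · refine (Computes.exp (.cons (.tl (.tl (.tl (.tl (.hd .arg))))) (.tl .arg)) rfl 3
        (fun p _ ↦ le_pow_of_le_mul 2 (hs₃ p)) (o := fun p ↦ .node p.2.qvar.enc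
          (encTerms (p.2.kid₁.fv p.1))) ?_).comp computes_filter
          (fun p ↦ (p.2.qvar, p.2.kid₁.fv p.1)) 3 (fun _ _ ↦ trivial) (fun _ _ ↦ rfl)
          (fun p hp ↦ le_pow_of_le_mul 2 ?_) |>.congr (fun _ _ ↦ rfl) ?_
      · rintro ⟨k, φ⟩ ⟨⟨_, h⟩, _⟩
        cases φ with
        | ex => rfl
        | _ => cases h
      · have h1 := hs₁ p
        obtain ⟨k, φ⟩ := p
        obtain ⟨⟨_, h⟩, _⟩ := hp
        cases φ with
        | ex => simp [Fm.qvar, Fm.enc] at *; omega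
        | _ => cases h
      · rintro ⟨k, φ⟩ ⟨⟨_, h⟩, h'⟩
        cases φ with
        | ex k' x φ =>
          have hk : k' = k := by
            by_contra hk
            simp [Fm.enc, ofBool_inj, hk] at h'
          simp only [Fm.fv, Fm.qvar, Fm.kid₁, hk, if_true]
          rfl
        | _ => cases h
    · rintro ⟨k, φ⟩ ⟨⟨_, h⟩, h'⟩
      cases φ with
      | ex k' x φ =>
        have hk : k' ≠ k := by
          rintro rfl
          simp [Fm.enc] at h'
        simp [Fm.fv, Fm.kid₁, hk]
      | _ => cases h
  · refine (Computes.exp (.tl .arg) rfl 4 (fun p _ ↦ le_pow_of_le_mul 3 ?_)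
      (fun _ _ ↦ rfl)).comp computes_append (fun p ↦ (p.2.kid₁.fv p.1, p.2.kid₂.fv p.1)) 3
      (fun _ _ ↦ trivial) (fun _ _ ↦ rfl) (fun p _ ↦ le_pow_of_le_mul 2 ?_) |>.congr
      (fun _ _ ↦ rfl) ?_
    · have := hs₁ p
      have := hs₂ p
      simp only [BTree.size]; omega
    · have := hs₁ p
      have := hs₂ p
      simp only [BTree.size]; omega
    · rintro ⟨k, φ⟩ ⟨_, h⟩
      cases φ with
      | imp => rfl
      | _ => cases h

/-! ### Programs for virtual substitution -/

theorem Point.size_subAtm_le (x : Term) (μ : Point) (s t : Term) (k : Bool) :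
    (μ.subAtm x s t k).enc.size ≤ μ.enc.size + (Fm.atm k s t).enc.size + 30 := by
  have := s.enc.one_le_size
  have := t.enc.one_le_size
  cases k <;> cases μ <;> simp only [Point.subAtm, Point.up, Point.low, Point.same] <;>
    split_ifs <;> simp [Point.enc, Fm.enc] <;> omega

/-- Every atom grows at most by the size of the test point and a constant. -/
theorem Fm.size_sub_le (k : Bool) (x : Term) (μ : Point) (φ : Fm) :
    (φ.sub k x μ).enc.size ≤ (μ.enc.size + 31) * φ.enc.size := by
  induction φ with
  | fls => simp [sub, enc]
  | atm k' s t =>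
    have h1 := Point.size_subAtm_le x μ s t k'
    have h2 := (atm k' s t).enc.one_le_size
    have h3 : (μ.enc.size + 31) * (atm k' s t).enc.size =
      (μ.enc.size + 30) * (atm k' s t).enc.size + (atm k' s t).enc.size := by ring
    have h4 : (μ.enc.size + 30) * 1 ≤ (μ.enc.size + 30) * (atm k' s t).enc.size :=
      Nat.mul_le_mul_left _ h2
    simp only [sub]
    split <;> omega
  | imp φ ψ ih₁ ih₂ =>
    simp only [sub, enc, BTree.size, mul_add, mul_one, BTree.ofTag] at *
    omega
  | ex k' y φ ih =>
    have h1 : 1 * (y.enc.size + 1 + (BTree.ofBool k').size) ≤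
      (μ.enc.size + 31) * (y.enc.size + 1 + (BTree.ofBool k').size) :=
        Nat.mul_le_mul_right _ (by omega)
    simp only [sub, enc, BTree.size, mul_add, mul_one, BTree.ofTag] at *
    omega

theorem computes_sub : Computes Set.univ
    (fun p : (Bool × Term × Point) × Fm ↦
      .node (.node (.ofBool p.1.1) (.node p.1.2.1.enc p.1.2.2.enc)) p.2.enc)
    (fun p ↦ (p.2.sub p.1.1 p.1.2.1 p.1.2.2).enc)
    (fun p ↦ (p.1.2.1.enc.size + p.1.2.2.enc.size + 31) * (p.2.enc.size + 4)) := by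
  have hmul : ∀ p : (Bool × Term × Point) × Fm,
      (p.1.2.1.enc.size + p.1.2.2.enc.size + 31) * 1 ≤
        (p.1.2.1.enc.size + p.1.2.2.enc.size + 31) * p.2.enc.size := fun p ↦
    Nat.mul_le_mul_left _ p.2.enc.one_le_size
  have hmul' : ∀ p : (Bool × Term × Point) × Fm, 31 * p.2.enc.size ≤
      (p.1.2.1.enc.size + p.1.2.2.enc.size + 31) * p.2.enc.size := fun p ↦
    Nat.mul_le_mul_right _ (by omega)
  have hs : ∀ p : (Bool × Term × Point) × Fm,
      (BTree.node (.node (.ofBool p.1.1) (.node p.1.2.1.enc p.1.2.2.enc)) p.2.enc).size ≤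
        (p.1.2.1.enc.size + p.1.2.2.enc.size + 31) * (p.2.enc.size + 4) := by
    intro p
    have h1 := BTree.size_ofBool_le p.1.1
    have := hmul p
    have := hmul' p
    simp only [BTree.size, mul_add]
    omega
  have hs' : ∀ (p : (Bool × Term × Point) × Fm) (φ : Fm), φ.enc.size ≤ p.2.enc.size →
      (φ.sub p.1.1 p.1.2.1 p.1.2.2).enc.size ≤
        (p.1.2.1.enc.size + p.1.2.2.enc.size + 31) * (p.2.enc.size + 4) := fun p φ hφ ↦
    (Fm.size_sub_le _ _ _ _).trans (Nat.mul_le_mul (by omega) (by omega))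
  refine .recur (fun p ↦ p.2.enc.size) (.hd (.tl .arg))
    (.cons (.hd .arg) (.hd (.tl (.tl .arg)))) (.cons (.hd .arg) (.tl (.tl (.tl .arg))))
    rfl rfl rfl (fun p ↦ (p.1, p.2.kid₁)) (fun p ↦ (p.1, p.2.kid₂)) (fun p _ ↦ hs p)
    (fun p _ ↦ ?_) ?_ ?_ ?_ ?_
  · have := hmul' p
    simp only [mul_add]
    omega
  · rintro ⟨⟨k, x, μ⟩, φ⟩ _
    have hle : ∀ ψ : Fm, ψ.enc.size ≤ φ.enc.size →
      (x.enc.size + μ.enc.size + 31) * (ψ.enc.size + 4) ≤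
        (x.enc.size + μ.enc.size + 31) * (φ.enc.size + 4) := fun ψ h ↦
      Nat.mul_le_mul_left _ (by omega)
    cases φ with
    | fls => exact .inl rfl
    | atm => exact .inl rfl
    | ex k' y φ =>
      exact .inr (.inl ⟨rfl, trivial, rfl, hle φ (Fm.size_kid₁_le (.ex k' y φ)),
        by simp [Fm.kid₁, Fm.enc]; omega⟩)
    | imp φ ψ =>
      exact .inr (.inr ⟨rfl, trivial, rfl, hle φ (Fm.size_kid₁_le (.imp φ ψ)), trivial, rfl,
        hle ψ (Fm.size_kid₂_le (.imp φ ψ)), by simp [Fm.kid₁, Fm.kid₂, Fm.enc]; omega⟩)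
  · let X : Exp := .hd (.tl (.hd .arg))
    let M : Exp := .tl (.tl (.hd .arg))
    let S : Exp := .hd (.tl (.tl (.tl .arg)))
    let T : Exp := .tl (.tl (.tl (.tl .arg)))
    let two : Exp := .cons .nil .tt
    let lt : Exp → Exp → Exp := fun a b ↦ .cons .nil (.cons .tt (.cons a b))
    let eq : Exp → Exp → Exp := fun a b ↦ .cons .nil (.cons .nil (.cons a b))
    let neg : Exp → Exp := fun a ↦ .cons two (.cons a .nil)
    -- the three cases of `Point.low`, `Point.up` and `Point.same`
    let low : Exp → Exp := fun a ↦ .ite M (.ite (.hd M) (lt a (.tl M)) (neg (lt (.tl M) a))) .nil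
    let up : Exp → Exp := fun a ↦ .ite M (lt (.tl M) a) (neg .nil)
    let same : Exp → Exp := fun a ↦ .ite M (.ite (.hd M) (eq a (.tl M)) .nil) .nil
    refine .exp (.ite (.tl .arg)
      (.ite (.equal (.hd (.tl (.tl .arg))) (.hd (.hd .arg)))
        (.ite (.hd (.hd .arg))
          (.ite (.equal S X) (.ite (.equal T X) .nil (up T))
            (.ite (.equal T X) (low S) (.tl .arg)))
          (.ite (.equal S X) (.ite (.equal T X) (neg .nil) (same T))
            (.ite (.equal T X) (same S) (.tl .arg)))) (.tl .arg)) .nil) rfl 2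
        (fun p _ ↦ le_pow_of_le_mul 1 ((hs p).trans (by omega))) ?_
    rintro ⟨⟨k, x, μ⟩, φ⟩ ⟨_, h⟩
    cases φ with
    | fls => rfl
    | atm k' s t =>
      by_cases hk : k' = k
      · subst hk
        by_cases hs : s = x <;> by_cases ht : t = x <;> cases k' <;> cases μ <;>
          simp [Fm.enc, Fm.sub, Point.subAtm, Point.up, Point.low, Point.same, Term.enc_inj,
            Point.enc, hs, ht, low, up, same, lt, eq, neg, two,
            X, M, S, T]
      · simp [Fm.enc, Fm.sub, ofBool_inj, hk]
    | ex => cases h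
    | imp => cases h
  · refine .exp (.cons .tt (.cons (.tl .arg) (.tl (.tl (.tl (.hd .arg)))))) rfl 3
      (fun p _ ↦ le_pow_of_le_mul 2 ?_) ?_
    · have h1 := hs p
      have h2 := hs' p p.2.kid₁ (Fm.size_kid₁_le _)
      simp only [BTree.size] at h1 ⊢
      omega
    · rintro ⟨⟨k, x, μ⟩, φ⟩ ⟨_, h⟩
      cases φ with
      | ex => rfl
      | _ => cases h
  · refine .exp (.cons (.cons .nil .tt) (.tl .arg)) rfl 4
      (fun p _ ↦ le_pow_of_le_mul 3 ?_) ?_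
    · have h1 := hs p
      have h2 := hs' p p.2.kid₁ (Fm.size_kid₁_le _)
      have h3 := hs' p p.2.kid₂ (Fm.size_kid₂_le _)
      simp only [BTree.size] at h1 ⊢
      omega
    · rintro ⟨⟨k, x, μ⟩, φ⟩ ⟨_, h⟩
      cases φ with
      | imp => rfl
      | _ => cases h

/-! ### Programs for quantifier elimination -/

/-- The elimination of one quantifier multiplies the size at most by a factor that is linear in the
size of the list of terms. -/
theorem Fm.size_elim_le (k : Bool) (x : Term) (φ : Fm) (T : List Term) :
    (elim k x φ T).enc.size ≤ 100 * ((encTerms T).size * φ.enc.size) := by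
  have hφ := φ.enc.one_le_size
  induction T with
  | nil =>
    have := size_sub_le k x .inf φ
    simp only [elim, Point.enc, encTerms, BTree.size] at *
    omega
  | cons t T ih =>
    have h1 := size_sub_le k x (.exact t) φ
    have h2 := size_sub_le k x (.plus t) φ
    have h3 : 1 * φ.enc.size ≤ t.enc.size * φ.enc.size :=
      Nat.mul_le_mul_right _ t.enc.one_le_size
    simp only [elim, enc, Point.enc, encTerms, BTree.size, BTree.ofTag, add_mul] at *
    omega

theorem computes_elim : Computes Set.univ
    (fun p : (Bool × Term × Fm) × List Term ↦
      .node (.node (.node (.ofBool p.1.1) p.1.2.1.enc) p.1.2.2.enc) (encTerms p.2))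
    (fun p ↦ (Fm.elim p.1.1 p.1.2.1 p.1.2.2 p.2).enc)
    (fun p ↦ 100 * ((p.1.2.1.enc.size + (encTerms p.2).size + 10) * p.1.2.2.enc.size)) := by
  have hmul : ∀ p : (Bool × Term × Fm) × List Term,
      (p.1.2.1.enc.size + (encTerms p.2).size + 10) * 1 ≤
        (p.1.2.1.enc.size + (encTerms p.2).size + 10) * p.1.2.2.enc.size := fun p ↦
    Nat.mul_le_mul_left _ p.1.2.2.enc.one_le_size
  have hmul' : ∀ p : (Bool × Term × Fm) × List Term, 10 * p.1.2.2.enc.size ≤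
      (p.1.2.1.enc.size + (encTerms p.2).size + 10) * p.1.2.2.enc.size := fun p ↦
    Nat.mul_le_mul_right _ (by omega)
  have hs : ∀ p : (Bool × Term × Fm) × List Term, (BTree.node (.node (.node (.ofBool p.1.1)
      p.1.2.1.enc) p.1.2.2.enc) (encTerms p.2)).size ≤
        100 * ((p.1.2.1.enc.size + (encTerms p.2).size + 10) * p.1.2.2.enc.size) := by
    intro p
    have h1 := BTree.size_ofBool_le p.1.1
    have := hmul p
    have := hmul' p
    simp only [BTree.size]
    omega
  have hs' : ∀ p : (Bool × Term × Fm) × List Term,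
      (Fm.elim p.1.1 p.1.2.1 p.1.2.2 p.2.tail).enc.size ≤
        100 * ((p.1.2.1.enc.size + (encTerms p.2).size + 10) * p.1.2.2.enc.size) := by
    intro p
    have := size_encTerms_tail_le p.2
    exact (Fm.size_elim_le _ _ _ _).trans (Nat.mul_le_mul_left _
      (Nat.mul_le_mul_right _ (by omega)))
  have hi : ∀ p : (Bool × Term × Fm) × List Term,
      (BTree.node (.node (.node (.node (.ofBool p.1.1) p.1.2.1.enc) p.1.2.2.enc) (encTerms p.2))
        (Fm.elim p.1.1 p.1.2.1 p.1.2.2 p.2.tail).enc).size ≤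
          2 * (100 * ((p.1.2.1.enc.size + (encTerms p.2).size + 10) * p.1.2.2.enc.size) + 2) := by
    intro p
    have h1 := hs p
    have h2 := hs' p
    rw [BTree.size]
    omega
  -- the bounds for the substitution of a test point that is not much larger than the terms
  have hsub : ∀ (p : (Bool × Term × Fm) × List Term) (μ : Point),
      μ.enc.size ≤ (encTerms p.2).size + 4 →
      (p.1.2.1.enc.size + μ.enc.size + 31) * (p.1.2.2.enc.size + 4) ≤
        1 * (100 * ((p.1.2.1.enc.size + (encTerms p.2).size + 10) * p.1.2.2.enc.size) + 2) := by
    intro p μ hμ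
    have := p.1.2.2.enc.one_le_size
    calc _ ≤ (4 * (p.1.2.1.enc.size + (encTerms p.2).size + 10)) * (5 * p.1.2.2.enc.size) :=
          Nat.mul_le_mul (by omega) (by omega)
      _ = 20 * ((p.1.2.1.enc.size + (encTerms p.2).size + 10) * p.1.2.2.enc.size) := by ring
      _ ≤ _ := by omega
  have hhead : ∀ L : List Term, L ≠ [] → (L.headD (.third 0)).enc.size ≤ (encTerms L).size := by
    intro L hL
    cases L with
    | nil => exact (hL rfl).elim
    | cons t L => simp only [List.headD_cons, encTerms, BTree.size]; omega
  refine .recur₁ (fun p ↦ (encTerms p.2).size) (.ite (.tl .arg) .tt .nil)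
    (.cons (.hd .arg) (.tl (.tl .arg))) rfl rfl (fun p ↦ (p.1, p.2.tail)) (fun p _ ↦ hs p)
    (fun p _ ↦ ?_) ?_ ?_ ?_
  · have := hmul p
    omega
  · rintro ⟨⟨k, x, φ⟩, _ | ⟨t, T⟩⟩ _
    · exact .inl rfl
    · refine .inr ⟨rfl, trivial, rfl, Nat.mul_le_mul_left _ (Nat.mul_le_mul_right _ ?_),
        by simp [encTerms]⟩
      simp [encTerms]; omega
  · refine (Computes.exp (.cons (.cons (.hd (.hd (.hd .arg))) (.cons (.tl (.hd (.hd .arg))) .nil))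
      (.tl (.hd .arg))) rfl 3 (fun p _ ↦ le_pow_of_le_mul 2 ((hs p).trans (by omega)))
      (fun _ _ ↦ rfl)).comp computes_sub (fun p ↦ ((p.1.1, p.1.2.1, .inf), p.1.2.2)) 2
      (fun _ _ ↦ trivial) (fun _ _ ↦ rfl) (fun p _ ↦ le_pow_of_le_mul 1 (hsub p .inf ?_))
      |>.congr (fun _ _ ↦ rfl) ?_
    · simp [Point.enc]
    · rintro ⟨⟨k, x, φ⟩, _ | ⟨t, T⟩⟩ ⟨_, h⟩
      · rfl
      · cases h
  · have hne : ∀ p : (Bool × Term × Fm) × List Term, p ∈ {p : (Bool × Term × Fm) × List Term |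
        p ∈ Set.univ ∧ (Exp.ite (.tl .arg) .tt .nil).den (.node (.node (.node (.ofBool p.1.1)
          p.1.2.1.enc) p.1.2.2.enc) (encTerms p.2)) = .ofTag 1} → p.2 ≠ [] := by
      rintro ⟨⟨k, x, φ⟩, _ | ⟨t, T⟩⟩ ⟨_, h⟩
      · cases h
      · simp
    have hE := (Computes.exp (.cons (.cons (.hd (.hd (.hd (.hd .arg))))
        (.cons (.tl (.hd (.hd (.hd .arg)))) (.cons .tt (.hd (.tl (.hd .arg))))))
        (.tl (.hd (.hd .arg)))) rfl 3 (fun p _ ↦ le_pow_of_le_mul 2 (hi p)) (o := fun p ↦ .node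
          (.node (.ofBool p.1.1) (.node p.1.2.1.enc (Point.exact (p.2.headD (.third 0))).enc))
          p.1.2.2.enc) (by
            rintro ⟨⟨k, x, φ⟩, _ | ⟨t, T⟩⟩ h
            · exact (hne _ h rfl).elim
            · rfl)).comp computes_sub
      (fun p ↦ ((p.1.1, p.1.2.1, .exact (p.2.headD (.third 0))), p.1.2.2)) 2
      (fun _ _ ↦ trivial) (fun _ _ ↦ rfl) (fun p hp ↦ le_pow_of_le_mul 1 (hsub p _ (by
        have := hhead _ (hne p hp)
        simp only [Point.enc, BTree.size, BTree.ofTag]; omega)))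
    have hP := (Computes.exp (.cons (.cons (.hd (.hd (.hd (.hd .arg))))
        (.cons (.tl (.hd (.hd (.hd .arg)))) (.cons .nil (.hd (.tl (.hd .arg))))))
        (.tl (.hd (.hd .arg)))) rfl 3 (fun p _ ↦ le_pow_of_le_mul 2 (hi p)) (o := fun p ↦ .node
          (.node (.ofBool p.1.1) (.node p.1.2.1.enc (Point.plus (p.2.headD (.third 0))).enc))
          p.1.2.2.enc) (by
            rintro ⟨⟨k, x, φ⟩, _ | ⟨t, T⟩⟩ h
            · exact (hne _ h rfl).elim
            · rfl)).comp computes_sub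
      (fun p ↦ ((p.1.1, p.1.2.1, .plus (p.2.headD (.third 0))), p.1.2.2)) 2
      (fun _ _ ↦ trivial) (fun _ _ ↦ rfl) (fun p hp ↦ le_pow_of_le_mul 1 (hsub p _ (by
        have := hhead _ (hne p hp)
        simp only [Point.enc, BTree.size]; omega)))
    have hR := Computes.exp (.tl .arg) rfl 3 (fun p hp ↦ le_pow_of_le_mul 2 (hi p))
      (fun p (hp : p ∈ {p : (Bool × Term × Fm) × List Term |
        p ∈ Set.univ ∧ (Exp.ite (.tl .arg) .tt .nil).den (.node (.node (.node (.ofBool p.1.1)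
          p.1.2.1.enc) p.1.2.2.enc) (encTerms p.2)) = .ofTag 1}) ↦ rfl)
    refine (hE.pair (hP.pair hR)).andThen
      (.cons (.cons .nil .tt) (.cons (.cons (.cons .nil .tt) (.cons (.hd .arg) .nil))
        (.cons (.cons .nil .tt) (.cons (.cons (.cons .nil .tt) (.cons (.hd (.tl .arg)) .nil))
          (.tl (.tl .arg)))))) rfl ?_
    rintro ⟨⟨k, x, φ⟩, _ | ⟨t, T⟩⟩ h
    · exact (hne _ h rfl).elim
    · rfl

theorem size_exs_le (k : Bool) (φ : Fm) (L : List Term) :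
    (Fm.exs k φ L).enc.size ≤ φ.enc.size + 10 * (encTerms L).size := by
  induction L with
  | nil => simp [Fm.exs]
  | cons t L ih =>
    have := BTree.size_ofBool_le k
    simp only [Fm.exs]
    split <;> simp only [Fm.enc, encTerms, BTree.size, BTree.ofTag] <;> omega

/-- No constant is mistaken for an attribute of the third tuple. -/
theorem encBits_head_ne (l : List Bool) : (encBits l).head ≠ .ofTag 3 := by
  rcases l with _ | ⟨_ | _, l⟩ <;> simp [encBits]

/-- Attributes of the third tuple are recognized by their encoding. -/
theorem Term.isThird_iff (t : Term) : t.isThird = true ↔ t.enc.tail.head = .ofTag 3 := by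
  cases t with
  | var v => cases v <;> simp [isThird, enc, Var.enc]
  | third i => simp [isThird, enc]
  | cst c => simpa [isThird, enc] using encBits_head_ne c
  | rat q => by_cases h : q < 0 <;> simp [isThird, enc, encRat, h]

theorem computes_exs : Computes Set.univ
    (fun p : (Bool × Fm) × List Term ↦
      .node (.node (.ofBool p.1.1) p.1.2.enc) (encTerms p.2))
    (fun p ↦ (Fm.exs p.1.1 p.1.2 p.2).enc)
    (fun p ↦ p.1.2.enc.size + 10 * (encTerms p.2).size + 10) := by
  have hs : ∀ p : (Bool × Fm) × List Term,
      (BTree.node (.node (.ofBool p.1.1) p.1.2.enc) (encTerms p.2)).size ≤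
        p.1.2.enc.size + 10 * (encTerms p.2).size + 10 := by
    intro p
    have := BTree.size_ofBool_le p.1.1
    simp only [BTree.size]; omega
  refine .recur₁ (fun p ↦ (encTerms p.2).size) (.ite (.tl .arg) .tt .nil)
    (.cons (.hd .arg) (.tl (.tl .arg))) rfl rfl (fun p ↦ (p.1, p.2.tail)) (fun p _ ↦ hs p)
    (fun p _ ↦ by omega) ?_ (.exp (.tl (.hd .arg)) rfl 2
      (fun p _ ↦ le_pow_of_le_mul 1 ((hs p).trans (by omega))) ?_)
    (.exp (.ite (.equal (.hd (.tl (.hd (.tl (.hd .arg))))) (.cons .nil (.cons .nil .tt)))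
      (.cons .tt (.cons (.tl .arg) (.cons (.hd (.hd (.hd .arg))) (.hd (.tl (.hd .arg))))))
      (.tl .arg)) rfl 3 (fun p _ ↦ le_pow_of_le_mul 2 ?_) ?_)
  · rintro ⟨⟨k, φ⟩, _ | ⟨t, L⟩⟩ _
    · exact .inl rfl
    · exact .inr ⟨rfl, trivial, rfl, by simp [encTerms]; omega, by simp [encTerms]⟩
  · rintro ⟨⟨k, φ⟩, _ | ⟨t, L⟩⟩ ⟨_, h⟩
    · rfl
    · cases h
  · have h1 := hs p
    have h2 := size_exs_le p.1.1 p.1.2 p.2.tail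
    have h3 := size_encTerms_tail_le p.2
    rw [BTree.size]
    dsimp only
    omega
  · rintro ⟨⟨k, φ⟩, _ | ⟨t, L⟩⟩ ⟨_, h⟩
    · cases h
    · have ht := t.isThird_iff
      by_cases h3 : t.isThird = true
      · have h4 := ht.1 h3
        simp at h4
        simp [Fm.exs, encTerms, h3, h4, Fm.enc]
      · have h4 := mt ht.2 h3
        simp at h4
        simp [Fm.exs, encTerms, h3, h4]

/-- Since the test points for a quantifier are those of the terms of the subformula of the given
formula, of which there are fewer than `N`, every quantifier contributes one factor `100 * N`. This
makes the bound singly exponential, whatever the nesting of the quantifiers is. -/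
theorem Fm.size_qe_le (N : ℕ) (φ : Fm) (h : φ.enc.size ≤ N) :
    φ.qe.enc.size ≤ (100 * N) ^ φ.enc.size := by
  have hN : 1 ≤ N := φ.enc.one_le_size.trans h
  have hself : ∀ ψ : Fm, ψ.enc.size ≤ N → ψ.enc.size ≤ (100 * N) ^ ψ.enc.size := fun ψ hψ ↦
    (show ψ.enc.size ≤ (100 * N) ^ 1 by rw [pow_one]; omega).trans
      (Nat.pow_le_pow_right (by omega) ψ.enc.one_le_size)
  induction φ with
  | fls => exact hself _ h
  | atm k s t => exact hself _ h
  | imp φ ψ ih₁ ih₂ =>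
    simp only [enc, BTree.size, BTree.ofTag] at h
    have h1 := ih₁ (by omega)
    have h2 := ih₂ (by omega)
    have h3 : (100 * N) ^ φ.enc.size ≤ (100 * N) ^ (φ.enc.size + ψ.enc.size) :=
      Nat.pow_le_pow_right (by omega) (by omega)
    have h4 : (100 * N) ^ ψ.enc.size ≤ (100 * N) ^ (φ.enc.size + ψ.enc.size) :=
      Nat.pow_le_pow_right (by omega) (by omega)
    have h5 : (100 * N) ^ (φ.enc.size + ψ.enc.size + 1) ≤ (100 * N) ^ (imp φ ψ).enc.size :=
      Nat.pow_le_pow_right (by omega) (by simp only [enc, BTree.size, BTree.ofTag]; omega)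
    have h6 : (100 * N) ^ (φ.enc.size + ψ.enc.size) * 100 ≤
        (100 * N) ^ (φ.enc.size + ψ.enc.size + 1) := by
      rw [pow_succ]; exact Nat.mul_le_mul_left _ (by omega)
    have h7 : 1 ≤ (100 * N) ^ (φ.enc.size + ψ.enc.size) := Nat.one_le_pow _ _ (by omega)
    refine le_trans ?_ h5
    simp only [qe, enc, BTree.size, BTree.ofTag]
    omega
  | ex k x φ ih =>
    have h0 := size_encTerms_fv_le k (ex k x φ)
    have h1 := ih (by simp only [enc, BTree.size] at h; omega)
    calc (ex k x φ).qe.enc.size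
        ≤ 100 * ((encTerms (fv k (ex k x φ))).size * φ.qe.enc.size) := size_elim_le _ _ _ _
      _ ≤ 100 * (N * (100 * N) ^ φ.enc.size) :=
          Nat.mul_le_mul_left _ (Nat.mul_le_mul (h0.trans h) h1)
      _ = (100 * N) ^ (φ.enc.size + 1) := by ring
      _ ≤ _ := Nat.pow_le_pow_right (by omega)
          (by simp only [enc, BTree.size, BTree.ofTag]; omega)

/-- A bound for the size of the formulas that occur in the quantifier elimination for `φ`. -/
def Fm.qeBound (φ : Fm) : ℕ := (100 * φ.enc.size) ^ φ.enc.size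

theorem Fm.qeBound_mono {φ ψ : Fm} (h : φ.enc.size ≤ ψ.enc.size) : φ.qeBound ≤ ψ.qeBound := by
  have := φ.enc.one_le_size
  exact (Nat.pow_le_pow_left (by omega) _).trans (Nat.pow_le_pow_right (by omega) h)

theorem Fm.size_le_qeBound (φ : Fm) : φ.enc.size ≤ φ.qeBound := by
  have := φ.enc.one_le_size
  exact (show φ.enc.size ≤ (100 * φ.enc.size) ^ 1 by rw [pow_one]; omega).trans
    (Nat.pow_le_pow_right (by omega) this)

theorem Fm.size_qe_le_qeBound {φ ψ : Fm} (h : φ.enc.size ≤ ψ.enc.size) :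
    φ.qe.enc.size ≤ ψ.qeBound :=
  (size_qe_le _ _ le_rfl).trans (qeBound_mono h)

theorem computes_qe : Computes Set.univ Fm.enc (fun φ ↦ φ.qe.enc) Fm.qeBound := by
  have hi : ∀ φ : Fm, (BTree.node φ.enc φ.kid₁.qe.enc).size ≤ 2 * (φ.qeBound + 2) := by
    intro φ
    have := φ.size_le_qeBound
    have := Fm.size_qe_le_qeBound φ.size_kid₁_le
    simp only [BTree.size]; omega
  refine .recur (fun φ ↦ φ.enc.size) (.hd .arg) (.hd (.tl .arg)) (.tl (.tl .arg)) rfl rfl rfl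
    Fm.kid₁ Fm.kid₂ (fun φ _ ↦ φ.size_le_qeBound) (fun φ _ ↦ φ.size_le_qeBound) ?_
    (.exp .arg rfl 2 (fun φ _ ↦ le_pow_of_le_mul 1 (φ.size_le_qeBound.trans (by omega))) ?_)
    ?_ (.exp (.cons (.cons .nil .tt) (.tl .arg)) rfl 4 (fun φ _ ↦ le_pow_of_le_mul 3 ?_) ?_)
  · intro φ _
    cases φ with
    | fls => exact .inl rfl
    | atm => exact .inl rfl
    | ex k' x φ =>
      exact .inr (.inl ⟨rfl, trivial, rfl, Fm.qeBound_mono (Fm.size_kid₁_le _),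
        by simp [Fm.kid₁, Fm.enc]; omega⟩)
    | imp φ ψ =>
      exact .inr (.inr ⟨rfl, trivial, rfl, Fm.qeBound_mono (Fm.size_kid₁_le _), trivial, rfl,
        Fm.qeBound_mono (Fm.size_kid₂_le _), by simp [Fm.kid₁, Fm.kid₂, Fm.enc]; omega⟩)
  · rintro φ ⟨_, h⟩
    cases φ with
    | fls => rfl
    | atm => rfl
    | _ => cases h
  · let sort : Fm → Bool := fun φ ↦ match φ with
      | .ex k _ _ => k
      | _ => false
    have hS : ∀ φ ∈ {φ : Fm | φ ∈ Set.univ ∧ (Exp.hd .arg).den φ.enc = .ofTag 1},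
        ∃ k x ψ, φ = .ex k x ψ := by
      rintro φ ⟨_, h⟩
      cases φ with
      | ex k x ψ => exact ⟨k, x, ψ, rfl⟩
      | _ => cases h
    have hfv := (Computes.exp (.cons (.hd (.tl (.tl (.hd .arg)))) (.hd .arg)) rfl 3
      (fun φ _ ↦ le_pow_of_le_mul 2 (hi φ)) (o := fun φ ↦ .node (.ofBool (sort φ)) φ.enc)
      (fun φ hφ ↦ by obtain ⟨k, x, ψ, rfl⟩ := hS φ hφ; rfl)).comp computes_fv
      (fun φ ↦ (sort φ, φ)) 4 (fun _ _ ↦ trivial) (fun _ _ ↦ rfl)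
      (fun φ _ ↦ le_pow_of_le_mul 3 (by
        have := φ.size_le_qeBound
        have := BTree.size_ofBool_le (sort φ)
        simp only [BTree.size]; omega))
    refine ((Computes.exp (.cons (.tl (.tl (.hd .arg))) (.tl .arg)) rfl 3
      (fun φ _ ↦ le_pow_of_le_mul 2 (hi φ))
      (o := fun φ ↦ .node (.node (.ofBool (sort φ)) φ.qvar.enc) φ.kid₁.qe.enc)
      (fun φ hφ ↦ by obtain ⟨k, x, ψ, rfl⟩ := hS φ hφ; rfl)).pair hfv).comp computes_elim
      (fun φ ↦ ((sort φ, φ.qvar, φ.kid₁.qe), φ.fv (sort φ))) (1000 + 2) (fun _ _ ↦ trivial)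
      (fun _ _ ↦ rfl) (fun φ hφ ↦ ?_) |>.congr (fun _ _ ↦ rfl) ?_
    · have h1 := φ.size_le_qeBound
      have h2 := Fm.size_qe_le_qeBound φ.size_kid₁_le
      have h3 := size_encTerms_fv_le (sort φ) φ
      have h4 : φ.qvar.enc.size ≤ φ.enc.size := by
        obtain ⟨k, x, ψ, rfl⟩ := hS φ hφ
        simp only [Fm.qvar, Fm.enc, BTree.size]; omega
      calc _ ≤ 100 * ((10 * (φ.qeBound + 2)) * (φ.qeBound + 2)) :=
            Nat.mul_le_mul_left _ (Nat.mul_le_mul (by dsimp only; omega) (by dsimp only; omega))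
        _ = 1000 * (φ.qeBound + 2) ^ 2 := by ring
        _ ≤ _ := const_mul_pow_le_pow le_rfl
    · intro φ hφ
      obtain ⟨k, x, ψ, rfl⟩ := hS φ hφ
      rfl
  · have := φ.size_le_qeBound
    have := Fm.size_qe_le_qeBound φ.size_kid₁_le
    have := Fm.size_qe_le_qeBound φ.size_kid₂_le
    simp only [BTree.size]; omega
  · rintro φ ⟨_, h⟩
    cases φ with
    | imp => rfl
    | _ => cases h

/-! ### Programs for the translations -/

namespace ERO

/-- The first direct subformula. -/
def kid₁ : ERO → ERO
  | not φ => φ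
  | and φ _ => φ
  | or φ _ => φ
  | exD _ φ => φ
  | exQ _ φ => φ
  | allD _ φ => φ
  | allQ _ φ => φ
  | _ => fls

/-- The second direct subformula. -/
def kid₂ : ERO → ERO
  | and _ ψ => ψ
  | or _ ψ => ψ
  | _ => fls

theorem size_kid₁_le (φ : ERO) : φ.kid₁.enc.size ≤ φ.enc.size := by
  cases φ <;> simp [kid₁, enc] <;> omega

theorem size_kid₂_le (φ : ERO) : φ.kid₂.enc.size ≤ φ.enc.size := by
  cases φ <;> simp [kid₂, enc] <;> omega

end ERO

theorem size_ren_le (b : Bool) (v : Var) : (ren b v).enc.size ≤ v.enc.size + 6 := by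
  cases v <;> cases b <;> simp [ren, Term.enc, Var.enc] <;> omega

theorem size_eqFm_le (s t : Term) (r : EqRel) :
    (eqFm s t r).enc.size ≤ s.enc.size + t.enc.size + 30 := by
  cases r <;> simp [eqFm, Fm.enc] <;> omega

theorem size_ordFm_le (s t : Term) (r : OrdRel) :
    (ordFm s t r).enc.size ≤ 2 * (s.enc.size + t.enc.size) + 50 := by
  cases r <;> simp [ordFm, Fm.enc] <;> omega

theorem ERO.size_trans_le (b : Bool) (φ : ERO) : (φ.trans b).enc.size ≤ 20 * φ.enc.size := by
  induction φ with
  | fls => simp [trans, Fm.enc, enc]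
  | eqVar r x y =>
    have := size_eqFm_le (ren b x) (ren b y) r
    have := size_ren_le b x
    have := size_ren_le b y
    simp only [trans, enc, BTree.size, BTree.ofTag]; omega
  | eqConst r x c =>
    have := size_eqFm_le (ren b x) (.cst c) r
    have := size_ren_le b x
    simp only [trans, enc, BTree.size, BTree.ofTag, Term.enc] at *; omega
  | ordVar r x y =>
    have := size_ordFm_le (ren b x) (ren b y) r
    have := size_ren_le b x
    have := size_ren_le b y
    simp only [trans, enc, BTree.size, BTree.ofTag]; omega
  | ordConst r x c =>
    have := size_ordFm_le (ren b x) (.rat c) r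
    have := size_ren_le b x
    simp only [trans, enc, BTree.size, BTree.ofTag, Term.enc] at *; omega
  | _ => simp only [trans, enc, Fm.enc, BTree.size, BTree.ofTag, Term.enc, Var.enc,
      BTree.ofBool_true, BTree.ofBool_false]; omega

/-- Case distinction by the value of a unary numeral. -/
def Exp.caseTag (g : Exp) : List Exp → Exp
  | [] => .nil
  | e :: es => .ite g (caseTag (.tl g) es) e

theorem computes_trans : Computes Set.univ
    (fun p : Bool × ERO ↦ .node (.ofBool p.1) p.2.enc)
    (fun p ↦ (p.2.trans p.1).enc)
    (fun p ↦ 20 * (BTree.node (.ofBool p.1) p.2.enc).size) := by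
  have h1 : ∀ p : Bool × ERO, (p.2.kid₁.trans p.1).enc.size ≤ 20 * p.2.enc.size := fun p ↦
    (ERO.size_trans_le _ _).trans (Nat.mul_le_mul_left _ (ERO.size_kid₁_le _))
  have h2 : ∀ p : Bool × ERO, (p.2.kid₂.trans p.1).enc.size ≤ 20 * p.2.enc.size := fun p ↦
    (ERO.size_trans_le _ _).trans (Nat.mul_le_mul_left _ (ERO.size_kid₂_le _))
  let two : Exp := .cons .nil .tt
  let lt : Exp → Exp → Exp := fun a b ↦ .cons .nil (.cons .tt (.cons a b))
  let eq : Exp → Exp → Exp := fun a b ↦ .cons .nil (.cons .nil (.cons a b))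
  let imp : Exp → Exp → Exp := fun a b ↦ .cons two (.cons a b)
  let neg : Exp → Exp := fun a ↦ imp a .nil
  -- the tag and the remainder of a formula
  let tag : Exp := .hd (.tl .arg)
  let rest : Exp := .tl (.tl .arg)
  refine .recur (fun p ↦ p.2.enc.size)
    (.caseTag tag [.nil, .nil, .nil, .nil, .nil, .tt, two, two, .tt, .tt, .tt, .tt])
    (.cons (.hd .arg) (.caseTag tag [.nil, .nil, .nil, .nil, .nil, rest, .hd rest, .hd rest,
      .tl rest, .tl rest, .tl rest, .tl rest]))
    (.cons (.hd .arg) (.tl rest)) rfl rfl rfl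
    (fun p ↦ (p.1, p.2.kid₁)) (fun p ↦ (p.1, p.2.kid₂)) (fun p _ ↦ by omega)
    (fun p _ ↦ by simp only [BTree.size]; omega) ?_ ?_ ?_ ?_
  · rintro ⟨b, φ⟩ _
    have g1 := φ.size_kid₁_le
    have g2 := φ.size_kid₂_le
    have g1' : 20 * (BTree.node (.ofBool b) φ.kid₁.enc).size ≤
      20 * (BTree.node (.ofBool b) φ.enc).size := by simp only [BTree.size]; omega
    have g2' : 20 * (BTree.node (.ofBool b) φ.kid₂.enc).size ≤
      20 * (BTree.node (.ofBool b) φ.enc).size := by simp only [BTree.size]; omega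
    cases φ with
    | fls => exact .inl rfl
    | eqVar => exact .inl rfl
    | eqConst => exact .inl rfl
    | ordVar => exact .inl rfl
    | ordConst => exact .inl rfl
    | and φ ψ =>
      exact .inr (.inr ⟨rfl, trivial, rfl, g1', trivial, rfl, g2',
        by simp [ERO.kid₁, ERO.kid₂, ERO.enc]; omega⟩)
    | or φ ψ =>
      exact .inr (.inr ⟨rfl, trivial, rfl, g1', trivial, rfl, g2',
        by simp [ERO.kid₁, ERO.kid₂, ERO.enc]; omega⟩)
    | _ => exact .inr (.inl ⟨rfl, trivial, rfl, g1', by simp [ERO.kid₁, ERO.enc]; try omega⟩)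
  · let renE : Exp → Exp := fun v ↦ .cons .nil (.ite (.hd v) (.ite (.tl (.hd v)) v
      (.cons (.cons .nil two) (.tl v))) (.cons (.hd .arg) (.tl v)))
    let eqE : Exp → Exp → Exp := fun a b ↦ .ite (.hd rest) (neg (eq a b)) (eq a b)
    let ordE : Exp → Exp → Exp := fun a b ↦ .caseTag (.hd rest)
      [neg (imp (neg (lt a b)) (lt b a)), imp (neg (lt a b)) (lt b a), lt a b, lt b a,
        neg (lt b a), neg (lt a b)]
    refine .exp (.caseTag tag [.nil,
      eqE (renE (.hd (.tl rest))) (renE (.tl (.tl rest))),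
      eqE (renE (.hd (.tl rest))) (.cons .tt (.tl (.tl rest))),
      ordE (renE (.hd (.tl rest))) (renE (.tl (.tl rest))),
      ordE (renE (.hd (.tl rest))) (.cons two (.tl (.tl rest)))]) rfl 2
      (fun p _ ↦ le_pow_of_le_mul 1 (by omega)) ?_
    rintro ⟨b, φ⟩ ⟨_, h⟩
    cases φ with
    | fls => rfl
    | eqVar r x y => cases b <;> cases r <;> cases x <;> cases y <;> rfl
    | eqConst r x c => cases b <;> cases r <;> cases x <;> rfl
    | ordVar r x y => cases b <;> cases r <;> cases x <;> cases y <;> rfl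
    | ordConst r x c => cases b <;> cases r <;> cases x <;> rfl
    | _ => cases h
  · let body : Exp := .tl .arg
    let ex : Exp → Exp → Exp := fun k a ↦ .cons .tt (.cons a (.cons k
      (.cons .nil (.cons two (.hd (.tl (.tl (.hd .arg))))))))
    refine .exp (.caseTag (.hd (.tl (.hd .arg))) [.nil, .nil, .nil, .nil, .nil, neg body, .nil,
      .nil, ex .nil body, ex .tt body, neg (ex .nil (neg body)), neg (ex .tt (neg body))]) rfl 3
      (fun p _ ↦ le_pow_of_le_mul 2 ?_) ?_
    · have := h1 p
      simp only [BTree.size]; omega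
    · rintro ⟨b, φ⟩ ⟨_, h⟩
      cases φ with
      | not => rfl
      | exD => rfl
      | exQ => rfl
      | allD => rfl
      | allQ => rfl
      | _ => cases h
  · let o₁ : Exp := .hd (.tl .arg)
    let o₂ : Exp := .tl (.tl .arg)
    refine .exp (.caseTag (.hd (.tl (.hd .arg))) [.nil, .nil, .nil, .nil, .nil, .nil,
      neg (imp o₁ (neg o₂)), imp (neg o₁) o₂]) rfl 4 (fun p _ ↦ le_pow_of_le_mul 3 ?_) ?_
    · have := h1 p
      have := h2 p
      simp only [BTree.size]; omega
    · rintro ⟨b, φ⟩ ⟨_, h⟩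
      cases φ with
      | and => rfl
      | or => rfl
      | _ => cases h

theorem computes_extFm : Computes Set.univ ERO.enc (fun φ ↦ φ.extFm.enc)
    (fun φ ↦ φ.enc.size) := by
  have hs : ∀ b : Bool, Computes Set.univ ERO.enc (fun φ ↦ .ofBool b) (fun φ ↦ φ.enc.size) :=
    fun b ↦ .exp (if b then .tt else .nil) (by cases b <;> rfl) 1 (fun φ _ ↦ by simp)
      (fun φ _ ↦ by cases b <;> rfl)
  have hsz : ∀ (b : Bool) (x y : ℕ), x ≤ y → ((BTree.ofBool b).size + x + 1) ≤ 4 * (y + 2) := by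
    intro b x y h
    have := BTree.size_ofBool_le b
    omega
  have ht : ∀ b : Bool, Computes Set.univ ERO.enc (fun φ ↦ (φ.trans b).enc)
      (fun φ ↦ φ.enc.size) := fun b ↦
    ((hs b).pair (.exp .arg rfl 1 (fun φ _ ↦ by simp) (fun _ _ ↦ rfl))).comp computes_trans
      (fun φ ↦ (b, φ)) (100 + 1) (fun _ _ ↦ trivial) (fun _ _ ↦ rfl)
      (fun φ _ ↦ le_pow_of_le_mul 100 (by
        have := hsz b φ.enc.size φ.enc.size le_rfl
        simp only [BTree.size]; omega))
  have hm : Computes Set.univ ERO.enc (fun φ ↦ φ.matrix.enc) (fun φ ↦ φ.enc.size) :=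
    ((ht false).pair (ht true)).andThen (.cons (.cons .nil .tt)
      (.cons (.cons (.cons .nil .tt) .arg) .nil)) rfl (fun _ _ ↦ rfl)
  obtain ⟨j, hj⟩ := hm.size_le
  have hf : ∀ b : Bool, Computes Set.univ ERO.enc (fun φ ↦ encTerms (φ.matrix.fv b))
      (fun φ ↦ φ.enc.size) := fun b ↦
    ((hs b).pair hm).comp computes_fv (fun φ ↦ (b, φ.matrix)) (5 + j) (fun _ _ ↦ trivial)
      (fun _ _ ↦ rfl) (fun φ _ ↦ by
        refine le_trans ?_ (const_mul_pow_le_pow (c := 5) (hj φ trivial))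
        have := BTree.size_ofBool_le b
        have := φ.matrix.enc.one_le_size
        simp only [BTree.size]; omega)
  have hex : ∀ (b : Bool) (ψ : ERO → Fm),
      Computes Set.univ ERO.enc (fun φ ↦ (ψ φ).enc) (fun φ ↦ φ.enc.size) →
      Computes Set.univ ERO.enc (fun φ ↦ (Fm.exs b (ψ φ) (φ.matrix.fv b)).enc)
        (fun φ ↦ φ.enc.size) := by
    intro b ψ hψ
    obtain ⟨l, hl⟩ := hψ.size_le
    refine (((hs b).pair hψ).pair (hf b)).comp computes_exs
      (fun φ ↦ ((b, ψ φ), φ.matrix.fv b)) (20 + (l + j + 2)) (fun _ _ ↦ trivial)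
      (fun _ _ ↦ rfl) (fun φ _ ↦ ?_)
    have h1 := size_encTerms_fv_le b φ.matrix
    refine le_trans ?_ (const_mul_pow_le_pow (c := 20)
      (add_pow_le_pow (hl φ trivial) (hj φ trivial)))
    dsimp only
    omega
  exact hex true _ (hex false _ hm)

theorem size_atmERO_le (k : Bool) (s t : Term) :
    (atmERO k s t).enc.size ≤ 10 * (Fm.atm k s t).enc.size := by
  cases k <;> cases s <;> cases t <;> simp only [atmERO] <;> (try split_ifs) <;>
    simp [ERO.enc, Fm.enc, Term.enc, EqRel.enc, OrdRel.enc] <;> omega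

theorem Fm.size_toERO_le (φ : Fm) : φ.toERO.enc.size ≤ 10 * φ.enc.size := by
  induction φ with
  | fls => simp [toERO, enc, ERO.enc]
  | atm k s t => exact size_atmERO_le k s t
  | imp φ ψ ih₁ ih₂ =>
    simp only [toERO, ERO.enc, enc, BTree.size, BTree.ofTag]; omega
  | ex k x φ => simp only [toERO, ERO.enc, enc, BTree.size, BTree.ofTag]; omega

theorem computes_toERO : Computes {φ : Fm | φ.Plain} Fm.enc (fun φ ↦ φ.toERO.enc)
    (fun φ ↦ 10 * φ.enc.size) := by
  have h1 : ∀ φ : Fm, φ.kid₁.toERO.enc.size ≤ 10 * φ.enc.size := fun φ ↦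
    (Fm.size_toERO_le _).trans (Nat.mul_le_mul_left _ φ.size_kid₁_le)
  have h2 : ∀ φ : Fm, φ.kid₂.toERO.enc.size ≤ 10 * φ.enc.size := fun φ ↦
    (Fm.size_toERO_le _).trans (Nat.mul_le_mul_left _ φ.size_kid₂_le)
  let s : Exp := .hd (.tl (.tl .arg))
  let t : Exp := .tl (.tl (.tl .arg))
  let k : Exp := .hd (.tl .arg)
  let tag : ℕ → Exp := fun n ↦ Nat.rec .nil (fun _ e ↦ .cons .nil e) n
  let atom : ℕ → ℕ → Exp → Exp → Exp := fun m n x y ↦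
    .cons (tag m) (.cons (tag n) (.cons (.tl x) (.tl y)))
  let fls : Exp := .cons .nil .nil
  let tru : Exp := .cons (tag 5) fls
  refine .recur (fun φ ↦ φ.enc.size) (.hd .arg) (.hd (.tl .arg)) (.tl (.tl .arg)) rfl rfl rfl
    Fm.kid₁ Fm.kid₂ (fun φ _ ↦ by omega) (fun φ _ ↦ by omega) ?_
    -- only atoms with two rational constants need a comparison of numbers
    (.ite (.ite (.tl (.hd s)) (.tl (.hd t)) .nil) rfl 2
      (fun φ _ ↦ le_pow_of_le_mul 1 (by omega)) ?_ (.exp (.ite .arg (.ite (.hd s)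
        (.ite (.hd t) (.ite (.equal s t) tru fls) (.ite k (atom 4 3 t s) (atom 2 0 t s)))
        (.ite (.hd t) (.ite k (atom 4 2 s t) (atom 2 0 s t))
          (.ite k (atom 3 2 s t) (atom 1 0 s t)))) fls) rfl 2
          (fun φ _ ↦ le_pow_of_le_mul 1 (by omega)) ?_))
    (.exp .nil rfl 3 (fun φ _ ↦ le_pow_of_le_mul 2 ?_) ?_)
    (.exp (.cons (tag 7) (.cons (.cons (tag 5) (.hd (.tl .arg))) (.tl (.tl .arg)))) rfl 4
      (fun φ _ ↦ le_pow_of_le_mul 3 ?_) ?_)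
  · intro φ hφ
    have g1 := φ.size_kid₁_le
    have g2 := φ.size_kid₂_le
    cases φ with
    | fls => exact .inl rfl
    | atm => exact .inl rfl
    | ex => exact hφ.elim
    | imp φ ψ =>
      exact .inr (.inr ⟨rfl, hφ.1, rfl, by omega, hφ.2, rfl, by omega,
        by simp [Fm.kid₁, Fm.kid₂, Fm.enc]; omega⟩)
  · have hS : ∀ φ ∈ {φ : Fm | φ ∈ {φ : Fm | φ ∈ {φ : Fm | φ.Plain} ∧
        (Exp.hd .arg).den φ.enc = .leaf} ∧
        (Exp.ite (.tl (.hd s)) (.tl (.hd t)) .nil).den φ.enc ≠ .leaf},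
        ∃ p q, φ = .atm true (.rat p) (.rat q) := by
      rintro φ ⟨⟨hφ, h⟩, h'⟩
      cases φ with
      | fls => exact (h' rfl).elim
      | atm k s t =>
        cases k <;> cases s <;> cases t <;>
          first | exact hφ.1.elim | exact hφ.2.elim | exact (h' rfl).elim | exact ⟨_, _, rfl⟩
      | _ => cases h
    let vals : Fm → ℚ × ℚ := fun φ ↦ match φ with
      | .atm _ (.rat p) (.rat q) => (p, q)
      | _ => (0, 0)
    refine ((Computes.exp (.cons (.tl s) (.tl t)) rfl 2
      (fun φ _ ↦ le_pow_of_le_mul 1 (by omega))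
      (o := fun φ ↦ .node (encRat (vals φ).1) (encRat (vals φ).2)) ?_).comp computes_ratLt vals 2
      (fun _ _ ↦ trivial) (fun _ _ ↦ rfl) (fun φ hφ ↦ le_pow_of_le_mul 1 ?_)).andThen
      (.ite .arg tru fls) rfl ?_
    · intro φ hφ
      obtain ⟨p, q, rfl⟩ := hS φ hφ
      rfl
    · obtain ⟨p, q, rfl⟩ := hS φ hφ
      simp only [vals, Fm.enc, Term.enc, BTree.size]; omega
    · intro φ hφ
      obtain ⟨p, q, rfl⟩ := hS φ hφ
      by_cases h : p < q <;> simp [vals, Fm.toERO, atmERO, h, ERO.enc, tru, fls, tag]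
  · rintro φ ⟨⟨hφ, h⟩, h'⟩
    cases φ with
    | fls => rfl
    | atm k s t =>
      cases k <;> cases s <;> cases t <;>
        first
        | exact hφ.1.elim
        | exact hφ.2.elim
        | (cases h'; done)
        | rfl
        | (rename_i c c'
           by_cases hc : c = c' <;> simp [Fm.toERO, atmERO, hc, ERO.enc, Fm.enc, Term.enc,
             encBits_inj, tru, fls, tag, s, t])
    | _ => cases h
  · have := h1 φ
    simp only [BTree.size]; omega
  · rintro φ ⟨hφ, h⟩
    cases φ with
    | ex => exact hφ.elim
    | _ => cases h
  · have := h1 φ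
    have := h2 φ
    simp only [BTree.size]; omega
  · rintro φ ⟨_, h⟩
    cases φ with
    | imp => rfl
    | _ => cases h

/-- The defining formula of the weak order extension is computed at a cost polynomial in the bound
for the quantifier elimination. -/
theorem computes_toERO_qe_extFm :
    Computes {φ : ERO | φ.extFm.qe.Plain} ERO.enc (fun φ ↦ φ.extFm.qe.toERO.enc)
      (fun φ ↦ φ.enc.size + φ.extFm.qeBound) := by
  have h1 : Computes {φ : ERO | φ.extFm.qe.Plain} ERO.enc (fun φ ↦ φ.extFm.enc)
      (fun φ ↦ φ.enc.size + φ.extFm.qeBound) :=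
    computes_extFm.comap id 1 (fun _ _ ↦ trivial) (fun φ _ ↦ by simp; omega)
  refine (h1.comp computes_qe ERO.extFm 1 (fun _ _ ↦ trivial) (fun _ _ ↦ rfl)
    (fun φ _ ↦ by simp; omega)).comp computes_toERO (fun φ ↦ φ.extFm.qe) (10 + 1)
    (fun φ hφ ↦ hφ) (fun _ _ ↦ rfl) (fun φ _ ↦ le_pow_of_le_mul 10 ?_)
  have := Fm.size_qe_le_qeBound (le_refl φ.extFm.enc.size)
  omega

/-! ### Semantics of the formulas with abstract terms -/

/-- Assignments of values to the terms of the two sorts. The values of the sort `𝒟` are coded as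
rational numbers, too. -/
abbrev Assign : Type := Bool → Term → ℚ

/-- Changing the value of the term `x` of sort `k`. -/
def Assign.set (σ : Assign) (k : Bool) (x : Term) (a : ℚ) : Assign :=
  fun k' y ↦ if k' = k ∧ y = x then a else σ k' y

/-- Truth of a formula. -/
def Fm.Holds : Fm → Assign → Prop
  | fls, _ => False
  | atm false s t, σ => σ false s = σ false t
  | atm true s t, σ => σ true s < σ true t
  | imp φ ψ, σ => φ.Holds σ → ψ.Holds σ
  | ex k x φ, σ => ∃ a : ℚ, φ.Holds (σ.set k x a)

/-- Formulas without quantifiers. -/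
def Fm.QF : Fm → Prop
  | fls => True
  | atm _ _ _ => True
  | imp φ ψ => φ.QF ∧ ψ.QF
  | ex _ _ _ => False

namespace Fm

theorem holds_congr {φ : Fm} {σ τ : Assign} (h : ∀ k, ∀ t ∈ φ.fv k, σ k t = τ k t) :
    φ.Holds σ ↔ φ.Holds τ := by
  induction φ generalizing σ τ with
  | fls => rfl
  | atm k s t =>
    have hs := h k s (by simp [fv])
    have ht := h k t (by simp [fv])
    cases k <;> simp only [Holds, hs, ht]
  | imp φ ψ ih₁ ih₂ =>
    simp only [Holds]
    rw [ih₁ (fun k t ht ↦ h k t (by simp [fv, ht])), ih₂ (fun k t ht ↦ h k t (by simp [fv, ht]))]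
  | ex k x φ ih =>
    refine exists_congr fun a ↦ ih fun k' t ht ↦ ?_
    simp only [Assign.set]
    split_ifs with hx
    · rfl
    · refine h k' t ?_
      simp only [fv]
      split_ifs with hk
      · simp only [List.mem_filter, decide_eq_true_eq]
        exact ⟨ht, fun e ↦ hx ⟨hk.symm, e⟩⟩
      · exact ht

theorem holds_disj {φ ψ : Fm} {σ : Assign} :
    (disj φ ψ).Holds σ ↔ φ.Holds σ ∨ ψ.Holds σ := by
  simp only [Holds]; tauto

theorem qf_sub {k : Bool} {x : Term} {μ : Point} {φ : Fm} (h : φ.QF) : (φ.sub k x μ).QF := by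
  induction φ with
  | fls => trivial
  | atm k' s t =>
    simp only [Fm.sub]
    split_ifs
    · cases k' <;> cases μ <;> simp only [Point.subAtm, Point.up, Point.low, Point.same] <;>
        split_ifs <;> simp [QF]
    · trivial
  | imp φ ψ ih₁ ih₂ => exact ⟨ih₁ h.1, ih₂ h.2⟩
  | ex => exact h.elim

theorem qf_elim {k : Bool} {x : Term} {φ : Fm} (h : φ.QF) (T : List Term) :
    (Fm.elim k x φ T).QF := by
  induction T with
  | nil => exact qf_sub h
  | cons t T ih => exact ⟨⟨qf_sub h, trivial⟩, ⟨qf_sub h, trivial⟩, ih⟩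

theorem qf_qe (φ : Fm) : φ.qe.QF := by
  induction φ with
  | fls => trivial
  | atm => trivial
  | imp φ ψ ih₁ ih₂ => exact ⟨ih₁, ih₂⟩
  | ex k x φ ih => exact qf_elim ih _

theorem holds_sub_exact {k : Bool} {x t : Term} {φ : Fm} (h : φ.QF) (σ : Assign) :
    (φ.sub k x (.exact t)).Holds σ ↔ φ.Holds (σ.set k x (σ k t)) := by
  induction φ with
  | fls => rfl
  | atm k' s u =>
    by_cases hk : k' = k
    · subst hk
      cases k' <;> by_cases hs : s = x <;> by_cases hu : u = x <;>
        simp [Fm.sub, Point.subAtm, Point.up, Point.low, Point.same, Holds, Assign.set, hs, hu,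
          eq_comm]
    · cases k' <;> simp [Fm.sub, Holds, Assign.set, hk]
  | imp φ ψ ih₁ ih₂ =>
    simp only [Fm.sub, Holds]
    rw [ih₁ h.1, ih₂ h.2]
  | ex => exact h.elim

end Fm

/-- The value `a` is not that of the term `s`, and is on the same side of it as the point. -/
def Point.Near (σ : Term → ℚ) (a : ℚ) (s : Term) : Point → Prop
  | inf => a < σ s
  | plus t => a ≠ σ s ∧ (σ s < a ↔ σ s ≤ σ t)
  | exact _ => False

namespace Fm

/-- Virtual substitution of a point is substitution of any value that is near to it. -/
theorem holds_sub_near {k : Bool} {x : Term} {μ : Point} {φ : Fm} (h : φ.QF) (σ : Assign) (a : ℚ)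
    (hμ : ∀ t, μ ≠ .exact t) (ha : ∀ s ∈ φ.fv k, s ≠ x → μ.Near (σ k) a s) :
    (φ.sub k x μ).Holds σ ↔ φ.Holds (σ.set k x a) := by
  induction φ with
  | fls => rfl
  | atm k' s u =>
    by_cases hk : k' = k
    · subst hk
      have hs' := ha s (by simp [fv])
      have hu' := ha u (by simp [fv])
      cases μ with
      | exact t => exact (hμ t rfl).elim
      | inf =>
        cases k' <;> by_cases hs : s = x <;> by_cases hu : u = x <;>
          simp_all [Fm.sub, Point.subAtm, Point.up, Point.low, Point.same, Holds, Assign.set,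
            Point.Near]
        · exact hu'.ne
        · exact hs'.ne'
        · exact hs'.le
      | plus t =>
        cases k' <;> by_cases hs : s = x <;> by_cases hu : u = x <;>
          simp_all [Fm.sub, Point.subAtm, Point.up, Point.low, Point.same, Holds, Assign.set,
            Point.Near]
        · exact fun e ↦ hs'.1 e.symm
        · rw [← not_le, ← hu'.2, not_lt]
          exact ⟨fun h ↦ lt_of_le_of_ne h hu'.1, le_of_lt⟩
    · cases k' <;> simp [Fm.sub, Holds, Assign.set, hk]
  | imp φ ψ ih₁ ih₂ =>
    simp only [Fm.sub, Holds]
    rw [ih₁ h.1 fun s hs ↦ ha s (by simp [fv, hs]), ih₂ h.2 fun s hs ↦ ha s (by simp [fv, hs])]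
  | ex => exact h.elim

theorem holds_elim_iff_exists_mem (k : Bool) (x : Term) (φ : Fm) (T : List Term) (σ : Assign) :
    (elim k x φ T).Holds σ ↔ (φ.sub k x .inf).Holds σ ∨
      ∃ t ∈ T, (φ.sub k x (.exact t)).Holds σ ∨ (φ.sub k x (.plus t)).Holds σ := by
  induction T with
  | nil => simp [elim]
  | cons t T ih =>
    rw [elim, holds_disj, holds_disj, ih]
    simp only [List.mem_cons, exists_eq_or_imp]
    rw [← or_assoc, or_left_comm]

theorem exists_lt_forall (L : List Term) (f : Term → ℚ) : ∃ a, ∀ s ∈ L, a < f s := by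
  induction L with
  | nil => exact ⟨0, by simp⟩
  | cons t L ih =>
    obtain ⟨a, ha⟩ := ih
    refine ⟨min a (f t - 1), fun s hs ↦ ?_⟩
    rcases List.mem_cons.1 hs with rfl | hs
    · exact (min_le_right _ _).trans_lt (by linarith)
    · exact (min_le_left _ _).trans_lt (ha s hs)

theorem exists_gt_forall (c : ℚ) (L : List Term) (f : Term → ℚ) :
    ∃ a, c < a ∧ ∀ s ∈ L, c < f s → a < f s := by
  induction L with
  | nil => exact ⟨c + 1, by linarith, by simp⟩
  | cons t L ih =>
    obtain ⟨a, hca, ha⟩ := ih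
    by_cases h : c < f t
    · obtain ⟨b, hb, hb'⟩ := exists_between h
      refine ⟨min a b, lt_min hca hb, fun s hs hcs ↦ ?_⟩
      rcases List.mem_cons.1 hs with rfl | hs
      · exact (min_le_right _ _).trans_lt hb'
      · exact (min_le_left _ _).trans_lt (ha s hs hcs)
    · refine ⟨a, hca, fun s hs hcs ↦ ?_⟩
      rcases List.mem_cons.1 hs with rfl | hs
      · exact (h hcs).elim
      · exact ha s hs hcs

/-- The test points suffice: a value that satisfies the formula either is the value of a term,
or can be moved down to just above the largest value of a term below it, or is below the values
of all terms and can be moved down to `-∞`. -/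
theorem holds_elim {k : Bool} {x : Term} {φ : Fm} (h : φ.QF) {T : List Term}
    (hT : ∀ s ∈ φ.fv k, s ≠ x → s ∈ T) (σ : Assign) :
    (elim k x φ T).Holds σ ↔ ∃ a, φ.Holds (σ.set k x a) := by
  rw [holds_elim_iff_exists_mem]
  constructor
  · rintro (hi | ⟨t, _, he | hp⟩)
    · obtain ⟨a, ha⟩ := exists_lt_forall (φ.fv k) (σ k)
      exact ⟨a, (holds_sub_near (μ := .inf) h σ a (by simp) fun s hs _ ↦ ha s hs).1 hi⟩
    · exact ⟨_, (holds_sub_exact h σ).1 he⟩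
    · obtain ⟨a, hta, ha⟩ := exists_gt_forall (σ k t) (φ.fv k) (σ k)
      refine ⟨a, (holds_sub_near h σ a (by simp) fun s hs _ ↦ ?_).1 hp⟩
      have := ha s hs
      refine ⟨fun e ↦ ?_, fun hsa ↦ ?_, fun hst ↦ hst.trans_lt hta⟩
      · rw [← e] at this
        exact lt_irrefl _ (this hta)
      · by_contra hts
        exact lt_asymm hsa (this (not_le.1 hts))
  · rintro ⟨a, ha⟩
    by_cases hval : ∃ t ∈ T, σ k t = a
    · obtain ⟨t, ht, rfl⟩ := hval
      exact .inr ⟨t, ht, .inl ((holds_sub_exact h σ).2 ha)⟩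
    · push Not at hval
      by_cases hlow : ∃ t ∈ T, σ k t < a
      · obtain ⟨t, ht, hmax⟩ := (T.toFinset.filter fun t ↦ σ k t < a).exists_max_image (σ k)
          (by obtain ⟨t, ht, hta⟩ := hlow; exact ⟨t, by simp [ht, hta]⟩)
        simp only [Finset.mem_filter, List.mem_toFinset, and_imp] at ht hmax
        refine .inr ⟨t, ht.1, .inr ((holds_sub_near h σ a (by simp) fun s hs hsx ↦ ?_).2 ha)⟩
        exact ⟨(hval s (hT s hs hsx)).symm, fun hsa ↦ hmax s (hT s hs hsx) hsa,
          fun hst ↦ hst.trans_lt ht.2⟩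
      · push Not at hlow
        refine .inl ((holds_sub_near h σ a (by simp) fun s hs hsx ↦ ?_).2 ha)
        exact lt_of_le_of_ne (hlow s (hT s hs hsx)) (hval s (hT s hs hsx)).symm

/-- After a virtual substitution for `x`, the free terms are old ones other than `x`, and the term
of the test point. -/
theorem mem_fv_sub {k k' : Bool} {x t : Term} {μ : Point} {φ : Fm} (h : φ.QF)
    (ht : t ∈ (φ.sub k x μ).fv k') :
    (t ∈ φ.fv k' ∧ ¬ (k' = k ∧ t = x)) ∨ (k' = k ∧ (μ = .plus t ∨ μ = .exact t)) := by
  induction φ with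
  | fls => simp [Fm.sub, fv] at ht
  | atm l s u =>
    by_cases hl : l = k
    · subst hl
      revert ht
      cases l <;> cases k' <;> cases μ <;> by_cases hs : s = x <;> by_cases hu : u = x <;>
        simp [Fm.sub, Point.subAtm, Point.up, Point.low, Point.same, fv, hs, hu] <;>
        grind
    · simp only [Fm.sub, hl, if_false] at ht
      refine .inl ⟨ht, fun e ↦ hl ?_⟩
      by_contra h'
      simp only [fv] at ht
      split_ifs at ht with h''
      · exact h' (h''.trans e.1)
      · simp at ht
  | imp φ ψ ih₁ ih₂ =>
    simp only [Fm.sub, fv, List.mem_append] at ht ⊢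
    rcases ht with ht | ht
    · rcases ih₁ h.1 ht with h' | h'
      · exact .inl ⟨.inl h'.1, h'.2⟩
      · exact .inr h'
    · rcases ih₂ h.2 ht with h' | h'
      · exact .inl ⟨.inr h'.1, h'.2⟩
      · exact .inr h'
  | ex => exact h.elim

theorem mem_fv_elim {k k' : Bool} {x t : Term} {φ : Fm} (h : φ.QF) {T : List Term}
    (ht : t ∈ (elim k x φ T).fv k') :
    (t ∈ φ.fv k' ∧ ¬ (k' = k ∧ t = x)) ∨ (k' = k ∧ t ∈ T) := by
  induction T with
  | nil =>
    have := mem_fv_sub h ht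
    simpa using this
  | cons u T ih =>
    simp only [elim, fv, List.mem_append, List.not_mem_nil, or_false] at ht
    rcases ht with ht | ht | ht
    · rcases mem_fv_sub h ht with h' | ⟨h', h''⟩
      · exact .inl h'
      · simp only [reduceCtorEq, Point.exact.injEq, false_or] at h''
        exact .inr ⟨h', by simp [h'']⟩
    · rcases mem_fv_sub h ht with h' | ⟨h', h''⟩
      · exact .inl h'
      · simp only [reduceCtorEq, Point.plus.injEq, or_false] at h''
        exact .inr ⟨h', by simp [h'']⟩
    · rcases ih ht with h' | ⟨h', h''⟩
      · exact .inl h'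
      · exact .inr ⟨h', by simp [h'']⟩

theorem mem_fv_ex {k k' : Bool} {x t : Term} {φ : Fm} :
    t ∈ (ex k x φ).fv k' ↔ t ∈ φ.fv k' ∧ ¬ (k' = k ∧ t = x) := by
  simp only [fv]
  split_ifs with h
  · simp [h]
  · simp [Ne.symm h]

/-- Quantifier elimination does not add free terms, so that the terms of the given subformula
provide all the test points that are needed. -/
theorem fv_qe_subset (k : Bool) (φ : Fm) : ∀ t ∈ φ.qe.fv k, t ∈ φ.fv k := by
  induction φ with
  | fls => exact fun t ht ↦ ht
  | atm => exact fun t ht ↦ ht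
  | imp φ ψ ih₁ ih₂ =>
    intro t ht
    simp only [qe, fv, List.mem_append] at ht ⊢
    exact ht.imp (ih₁ t) (ih₂ t)
  | ex k' x φ ih =>
    intro t ht
    rcases mem_fv_elim (qf_qe φ) ht with ⟨h, h'⟩ | ⟨rfl, h⟩
    · exact mem_fv_ex.2 ⟨ih t h, h'⟩
    · exact h

theorem holds_qe (φ : Fm) (σ : Assign) : φ.qe.Holds σ ↔ φ.Holds σ := by
  induction φ generalizing σ with
  | fls => rfl
  | atm => rfl
  | imp φ ψ ih₁ ih₂ =>
    simp only [qe, Holds]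
    rw [ih₁, ih₂]
  | ex k x φ ih =>
    rw [qe, holds_elim (qf_qe φ) fun s hs hsx ↦ mem_fv_ex.2
      ⟨fv_qe_subset k φ s hs, fun h ↦ hsx h.2⟩]
    exact exists_congr fun a ↦ ih _

theorem mem_fv_exs {k k' : Bool} {t : Term} {φ : Fm} {L : List Term}
    (h : t ∈ (exs k φ L).fv k') : t ∈ φ.fv k' ∧ ¬ (k' = k ∧ t.isThird = true ∧ t ∈ L) := by
  induction L with
  | nil => exact ⟨h, by simp⟩
  | cons u L ih =>
    simp only [exs] at h
    split_ifs at h with hu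
    · obtain ⟨h1, h2⟩ := mem_fv_ex.1 h
      refine ⟨(ih h1).1, fun ⟨h3, h4, h5⟩ ↦ ?_⟩
      rcases List.mem_cons.1 h5 with h6 | h6
      · exact h2 ⟨h3, h6⟩
      · exact (ih h1).2 ⟨h3, h4, h6⟩
    · refine ⟨(ih h).1, fun ⟨h3, h4, h5⟩ ↦ ?_⟩
      rcases List.mem_cons.1 h5 with rfl | h6
      · exact hu h4
      · exact (ih h).2 ⟨h3, h4, h6⟩

/-- Quantifying over attributes of the third tuple amounts to changing their values. -/
theorem holds_exs {k : Bool} {φ : Fm} {L : List Term} {σ : Assign} :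
    (exs k φ L).Holds σ ↔ ∃ τ : Assign,
      (∀ k' t, ¬ (k' = k ∧ t.isThird = true ∧ t ∈ L) → τ k' t = σ k' t) ∧ φ.Holds τ := by
  induction L generalizing σ with
  | nil =>
    refine ⟨fun h ↦ ⟨σ, fun _ _ _ ↦ rfl, h⟩, ?_⟩
    rintro ⟨τ, hτ, h⟩
    have : τ = σ := by
      funext k' t
      exact hτ k' t (by simp)
    exact this ▸ h
  | cons u L ih =>
    simp only [exs]
    split_ifs with hu
    · simp only [Holds, ih]
      constructor
      · rintro ⟨a, τ, hτ, h⟩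
        refine ⟨τ, fun k' t ht ↦ ?_, h⟩
        rw [hτ k' t fun ⟨h1, h2, h3⟩ ↦ ht ⟨h1, h2, List.mem_cons_of_mem _ h3⟩, Assign.set,
          if_neg]
        rintro ⟨h1, rfl⟩
        exact ht ⟨h1, hu, List.mem_cons_self⟩
      · rintro ⟨τ, hτ, h⟩
        refine ⟨τ k u, τ, fun k' t ht ↦ ?_, h⟩
        simp only [Assign.set]
        split_ifs with h1
        · rw [h1.1, h1.2]
        · refine hτ k' t fun ⟨h2, h3, h4⟩ ↦ ?_
          rcases List.mem_cons.1 h4 with h5 | h5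
          · exact h1 ⟨h2, h5⟩
          · exact ht ⟨h2, h3, h5⟩
    · rw [ih]
      refine exists_congr fun τ ↦ and_congr_left fun _ ↦ forall_congr' fun k' ↦
        forall_congr' fun t ↦ ?_
      have : (t.isThird = true ∧ t ∈ u :: L) ↔ (t.isThird = true ∧ t ∈ L) := by
        refine and_congr_right fun ht ↦ ?_
        rw [List.mem_cons]
        refine or_iff_right ?_
        rintro rfl
        exact hu ht
      rw [this]

end Fm

/-! ### Translations between ERO formulas and formulas with abstract terms -/

/-- Truth of an ERO formula depends only on the values of its free variables. -/
theorem ERO.holds_congr {φ : ERO} {d d' : Var → Const} {q q' : Var → ℚ}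
    (hd : ∀ v ∈ φ.freeD, d v = d' v) (hq : ∀ v ∈ φ.freeQ, q v = q' v) :
    φ.Holds d q ↔ φ.Holds d' q' := by
  have hupd : ∀ {α : Type} {S : Set Var} {f g : Var → α} (n : ℕ) (a : α),
      (∀ v ∈ S \ {Var.bound n}, f v = g v) →
      ∀ v ∈ S, Function.update f (.bound n) a v = Function.update g (.bound n) a v := by
    intro α S f g n a h v hv
    by_cases hn : v = .bound n
    · simp [hn]
    · simp [hn, h v ⟨hv, hn⟩]
  induction φ generalizing d d' q q' with
  | fls => rfl
  | eqVar r x y => simp only [Holds]; rw [hd x (by simp [freeD]), hd y (by simp [freeD])]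
  | eqConst r x c => simp only [Holds]; rw [hd x (by simp [freeD])]
  | ordVar r x y => simp only [Holds]; rw [hq x (by simp [freeQ]), hq y (by simp [freeQ])]
  | ordConst r x c => simp only [Holds]; rw [hq x (by simp [freeQ])]
  | not φ ih => exact not_congr (ih hd hq)
  | and φ ψ ih₁ ih₂ =>
    exact and_congr (ih₁ (fun v h ↦ hd v (.inl h)) fun v h ↦ hq v (.inl h))
      (ih₂ (fun v h ↦ hd v (.inr h)) fun v h ↦ hq v (.inr h))
  | or φ ψ ih₁ ih₂ =>
    exact or_congr (ih₁ (fun v h ↦ hd v (.inl h)) fun v h ↦ hq v (.inl h))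
      (ih₂ (fun v h ↦ hd v (.inr h)) fun v h ↦ hq v (.inr h))
  | exD n φ ih => exact exists_congr fun a ↦ ih (hupd n a hd) hq
  | exQ n φ ih => exact exists_congr fun a ↦ ih hd (hupd n a hq)
  | allD n φ ih => exact forall_congr' fun a ↦ ih (hupd n a hd) hq
  | allQ n φ ih => exact forall_congr' fun a ↦ ih hd (hupd n a hq)

theorem ren_eq_bound_iff {b : Bool} {v : Var} {n : ℕ} :
    ren b v = .var (.bound n) ↔ v = .bound n := by
  cases v <;> cases b <;> simp [ren]

/-- The constants have their values, with the constants of `𝒟` coded by `e`. -/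
def Assign.Std (e : Const ≃ ℚ) (σ : Assign) : Prop :=
  (∀ c, σ false (.cst c) = e c) ∧ ∀ q, σ true (.rat q) = q

/-- Quantifiers bind no constants. -/
theorem Assign.Std.set {e : Const ≃ ℚ} {σ : Assign} (h : σ.Std e) (k : Bool) (v : Var) (a : ℚ) :
    (σ.set k (.var v) a).Std e := by
  constructor
  · intro c; simpa [Assign.set] using h.1 c
  · intro q; simpa [Assign.set] using h.2 q

theorem Assign.set_ren (σ : Assign) (k k' : Bool) (n : ℕ) (a : ℚ) (b : Bool) (v : Var) :
    σ.set k (.var (.bound n)) a k' (ren b v) = if k' = k then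
      Function.update (fun v ↦ σ k' (ren b v)) (.bound n) a v else σ k' (ren b v) := by
  simp only [Assign.set, ren_eq_bound_iff, Function.update_apply]
  by_cases hk : k' = k <;> by_cases hv : v = .bound n <;> simp [hk, hv]

theorem holds_eqFm (σ : Assign) (s t : Term) (r : EqRel) (e : Const ≃ ℚ) :
    (eqFm s t r).Holds σ ↔ r.Holds (e.symm (σ false s)) (e.symm (σ false t)) := by
  cases r <;> simp [eqFm, Fm.Holds, EqRel.Holds]

theorem holds_ordFm (σ : Assign) (s t : Term) (r : OrdRel) :
    (ordFm s t r).Holds σ ↔ r.Holds (σ true s) (σ true t) := by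
  cases r <;> simp [ordFm, Fm.Holds, OrdRel.Holds]
  · exact ⟨fun h ↦ le_antisymm h.2 h.1, fun h ↦ ⟨h.ge, h.le⟩⟩
  · exact ⟨fun h e ↦ by rw [e] at h; exact lt_irrefl _ (h le_rfl),
      fun h h' ↦ lt_of_le_of_ne h' (Ne.symm h)⟩

theorem ERO.holds_trans {e : Const ≃ ℚ} {b : Bool} {φ : ERO} {σ : Assign} (h : σ.Std e) :
    (φ.trans b).Holds σ ↔
      φ.Holds (fun v ↦ e.symm (σ false (ren b v))) (fun v ↦ σ true (ren b v)) := by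
  have hD : ∀ (σ : Assign) (n : ℕ) (a : ℚ) (φ : ERO),
      φ.Holds (fun v ↦ e.symm (σ.set false (.var (.bound n)) a false (ren b v)))
        (fun v ↦ σ.set false (.var (.bound n)) a true (ren b v)) ↔
      φ.Holds (Function.update (fun v ↦ e.symm (σ false (ren b v))) (.bound n) (e.symm a))
        (fun v ↦ σ true (ren b v)) := by
    intro σ n a φ
    refine holds_congr (fun v _ ↦ ?_) (fun v _ ↦ ?_)
    · rw [Assign.set_ren]
      by_cases hv : v = .bound n <;> simp [hv]
    · rw [Assign.set_ren]; simp
  have hQ : ∀ (σ : Assign) (n : ℕ) (a : ℚ) (φ : ERO),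
      φ.Holds (fun v ↦ e.symm (σ.set true (.var (.bound n)) a false (ren b v)))
        (fun v ↦ σ.set true (.var (.bound n)) a true (ren b v)) ↔
      φ.Holds (fun v ↦ e.symm (σ false (ren b v)))
        (Function.update (fun v ↦ σ true (ren b v)) (.bound n) a) := by
    intro σ n a φ
    refine holds_congr (fun v _ ↦ ?_) (fun v _ ↦ ?_)
    · rw [Assign.set_ren]; simp
    · rw [Assign.set_ren]; simp
  induction φ generalizing σ with
  | fls => rfl
  | eqVar r x y => exact holds_eqFm σ _ _ r e
  | eqConst r x c =>
    refine (holds_eqFm σ _ _ r e).trans ?_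
    simp only [Holds]
    rw [h.1, e.symm_apply_apply]
  | ordVar r x y => exact holds_ordFm σ _ _ r
  | ordConst r x c =>
    refine (holds_ordFm σ _ _ r).trans ?_
    simp only [Holds]
    rw [h.2]
  | not φ ih => exact not_congr (ih h)
  | and φ ψ ih₁ ih₂ =>
    simp only [trans, Fm.Holds, Holds, ih₁ h, ih₂ h]
    tauto
  | or φ ψ ih₁ ih₂ =>
    simp only [trans, Fm.holds_disj, Holds, ih₁ h, ih₂ h]
  | exD n φ ih =>
    simp only [trans, Fm.Holds, Holds, ih (h.set _ _ _), hD]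
    exact e.symm.exists_congr_left.trans (by simp)
  | exQ n φ ih => simp only [trans, Fm.Holds, Holds, ih (h.set _ _ _), hQ]
  | allD n φ ih =>
    simp only [trans, Fm.Holds, Holds, ih (h.set _ _ _), hD]
    exact ⟨fun H c ↦ by_contra fun hc ↦ H ⟨e c, by simpa using hc⟩,
      fun H ⟨a, ha⟩ ↦ ha (H (e.symm a))⟩
  | allQ n φ ih =>
    simp only [trans, Fm.Holds, Holds, ih (h.set _ _ _), hQ]
    simp

theorem mem_fv_eqFm {k : Bool} {s t u : Term} {r : EqRel} (h : u ∈ (eqFm s t r).fv k) :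
    k = false ∧ (u = s ∨ u = t) := by
  cases r <;> cases k <;> simp [eqFm, Fm.fv] at h <;> simp [h]

theorem mem_fv_ordFm {k : Bool} {s t u : Term} {r : OrdRel} (h : u ∈ (ordFm s t r).fv k) :
    k = true ∧ (u = s ∨ u = t) := by
  cases r <;> cases k <;> simp [ordFm, Fm.fv] at h <;> simp <;> tauto

/-- The free variables of a sort. -/
def ERO.free (φ : ERO) : Bool → Set Var
  | false => φ.freeD
  | true => φ.freeQ

/-- The free terms of a translated formula are its renamed free variables and constants. -/
theorem ERO.mem_fv_trans {k b : Bool} {φ : ERO} {t : Term} (h : t ∈ (φ.trans b).fv k) :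
    (∃ v ∈ φ.free k, t = ren b v) ∨
      ((k = false ∧ ∃ c, t = .cst c) ∨ (k = true ∧ ∃ q, t = .rat q)) := by
  induction φ with
  | fls => simp [trans, Fm.fv] at h
  | eqVar r x y =>
    obtain ⟨rfl, rfl | rfl⟩ := mem_fv_eqFm h
    · exact .inl ⟨x, by simp [free, freeD], rfl⟩
    · exact .inl ⟨y, by simp [free, freeD], rfl⟩
  | eqConst r x c =>
    obtain ⟨rfl, rfl | rfl⟩ := mem_fv_eqFm h
    · exact .inl ⟨x, by simp [free, freeD], rfl⟩
    · exact .inr (.inl ⟨rfl, c, rfl⟩)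
  | ordVar r x y =>
    obtain ⟨rfl, rfl | rfl⟩ := mem_fv_ordFm h
    · exact .inl ⟨x, by simp [free, freeQ], rfl⟩
    · exact .inl ⟨y, by simp [free, freeQ], rfl⟩
  | ordConst r x c =>
    obtain ⟨rfl, rfl | rfl⟩ := mem_fv_ordFm h
    · exact .inl ⟨x, by simp [free, freeQ], rfl⟩
    · exact .inr (.inr ⟨rfl, c, rfl⟩)
  | not φ ih =>
    simp only [trans, Fm.fv, List.append_nil] at h
    cases k <;> exact ih h
  | and φ ψ ih₁ ih₂ =>
    simp only [trans, Fm.fv, List.append_nil, List.mem_append] at h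
    rcases h with h | h
    · exact (ih₁ h).imp (fun ⟨v, hv, e⟩ ↦ ⟨v, by cases k <;> exact .inl hv, e⟩) id
    · exact (ih₂ h).imp (fun ⟨v, hv, e⟩ ↦ ⟨v, by cases k <;> exact .inr hv, e⟩) id
  | or φ ψ ih₁ ih₂ =>
    simp only [trans, Fm.fv, List.append_nil, List.mem_append] at h
    rcases h with h | h
    · exact (ih₁ h).imp (fun ⟨v, hv, e⟩ ↦ ⟨v, by cases k <;> exact .inl hv, e⟩) id
    · exact (ih₂ h).imp (fun ⟨v, hv, e⟩ ↦ ⟨v, by cases k <;> exact .inr hv, e⟩) id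
  | exD n φ ih =>
    obtain ⟨h, h'⟩ := Fm.mem_fv_ex.1 h
    refine (ih h).imp ?_ id
    rintro ⟨v, hv, rfl⟩
    rw [ren_eq_bound_iff] at h'
    refine ⟨v, ?_, rfl⟩
    cases k
    · exact ⟨hv, fun e ↦ h' ⟨rfl, e⟩⟩
    · exact hv
  | exQ n φ ih =>
    obtain ⟨h, h'⟩ := Fm.mem_fv_ex.1 h
    refine (ih h).imp ?_ id
    rintro ⟨v, hv, rfl⟩
    rw [ren_eq_bound_iff] at h'
    refine ⟨v, ?_, rfl⟩
    cases k
    · exact hv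
    · exact ⟨hv, fun e ↦ h' ⟨rfl, e⟩⟩
  | allD n φ ih =>
    simp only [trans] at h
    rw [Fm.fv, List.mem_append, Fm.mem_fv_ex] at h
    simp only [Fm.fv, List.append_nil, List.not_mem_nil, or_false] at h
    obtain ⟨h, h'⟩ := h
    refine (ih h).imp ?_ id
    rintro ⟨v, hv, rfl⟩
    rw [ren_eq_bound_iff] at h'
    refine ⟨v, ?_, rfl⟩
    cases k
    · exact ⟨hv, fun e ↦ h' ⟨rfl, e⟩⟩
    · exact hv
  | allQ n φ ih =>
    simp only [trans] at h
    rw [Fm.fv, List.mem_append, Fm.mem_fv_ex] at h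
    simp only [Fm.fv, List.append_nil, List.not_mem_nil, or_false] at h
    obtain ⟨h, h'⟩ := h
    refine (ih h).imp ?_ id
    rintro ⟨v, hv, rfl⟩
    rw [ren_eq_bound_iff] at h'
    refine ⟨v, ?_, rfl⟩
    cases k
    · exact hv
    · exact ⟨hv, fun e ↦ h' ⟨rfl, e⟩⟩

/-- The values of the terms under an assignment of the variables; the attributes of the third
tuple are given junk values. -/
def termVal (e : Const ≃ ℚ) (d : Var → Const) (q : Var → ℚ) : Assign
  | false, .var v => e (d v)
  | true, .var v => q v
  | false, .cst c => e c
  | true, .rat r => r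
  | _, _ => 0

theorem holds_atmERO (e : Const ≃ ℚ) {k : Bool} {s t : Term} (hs : s.HasSort k)
    (ht : t.HasSort k) (d : Var → Const) (q : Var → ℚ) :
    (atmERO k s t).Holds d q ↔ (Fm.atm k s t).Holds (termVal e d q) := by
  cases k <;> cases s <;> cases t <;>
    first
    | exact hs.elim
    | exact ht.elim
    | (simp [atmERO, Fm.Holds, ERO.Holds, termVal, OrdRel.Holds, EqRel.Holds, eq_comm]; done)
    | (simp only [atmERO, Fm.Holds, termVal, e.apply_eq_iff_eq]
       split_ifs with h <;> simp [ERO.Holds, h])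

theorem Fm.holds_toERO (e : Const ≃ ℚ) {φ : Fm} (h : φ.Plain) (d : Var → Const) (q : Var → ℚ) :
    φ.toERO.Holds d q ↔ φ.Holds (termVal e d q) := by
  induction φ with
  | fls => rfl
  | atm k s t => exact holds_atmERO e h.1 h.2 d q
  | imp φ ψ ih₁ ih₂ =>
    simp only [toERO, ERO.Holds, Holds]
    rw [ih₁ h.1, ih₂ h.2, imp_iff_not_or]
  | ex => exact h.elim

theorem Fm.quantifierFree_toERO (φ : Fm) : φ.toERO.QuantifierFree := by
  induction φ with
  | fls => trivial
  | atm k s t =>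
    cases k <;> cases s <;> cases t <;> simp only [toERO, atmERO] <;> (try split_ifs) <;> trivial
  | imp φ ψ ih₁ ih₂ => exact ⟨ih₁, ih₂⟩
  | ex => trivial

/-- Translation into ERO formulas adds no variables; it may lose some, in ill-sorted atoms. -/
theorem Fm.mem_free_toERO {φ : Fm} {k : Bool} {v : Var} (h : v ∈ φ.toERO.free k) :
    .var v ∈ φ.fv k := by
  induction φ with
  | fls => cases k <;> exact h.elim
  | atm k' s t =>
    revert h
    cases k <;> cases k' <;> cases s <;> cases t <;> simp only [toERO, atmERO] <;>
      (try split_ifs) <;> simp [ERO.free, ERO.freeD, ERO.freeQ, fv]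
  | imp φ ψ ih₁ ih₂ =>
    simp only [fv, List.mem_append]
    cases k <;> exact Or.imp ih₁ ih₂ h
  | ex => cases k <;> exact h.elim

theorem Fm.plain_of_qf {φ : Fm} (h : φ.QF) (hs : ∀ k, ∀ t ∈ φ.fv k, t.HasSort k) : φ.Plain := by
  induction φ with
  | fls => trivial
  | atm k s t => exact ⟨hs k s (by simp [fv]), hs k t (by simp [fv])⟩
  | imp φ ψ ih₁ ih₂ =>
    exact ⟨ih₁ h.1 fun k t ht ↦ hs k t (by simp [fv, ht]),
      ih₂ h.2 fun k t ht ↦ hs k t (by simp [fv, ht])⟩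
  | ex => exact h.elim

/-! ### The third tuple -/

/-- Giving values to the attributes of the third tuple. -/
def Assign.withThird (σ : Assign) (f : Bool → ℕ → ℚ) : Assign
  | k, .third i => f k i
  | k, t => σ k t

theorem ERO.holds_extFm (φ : ERO) (σ : Assign) :
    φ.extFm.Holds σ ↔ ∃ f, φ.matrix.Holds (σ.withThird f) := by
  simp only [extFm, Fm.holds_exs]
  constructor
  · rintro ⟨τ, hτ, ρ, hρ, h⟩
    refine ⟨fun k i ↦ ρ k (.third i), ?_⟩
    have : σ.withThird (fun k i ↦ ρ k (.third i)) = ρ := by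
      funext k t
      cases t with
      | third i => rfl
      | _ =>
        simp only [Assign.withThird]
        rw [hρ _ _ (by simp [Term.isThird]), hτ _ _ (by simp [Term.isThird])]
    rwa [this]
  · rintro ⟨f, h⟩
    have hth : ∀ k t, t.isThird = false → σ.withThird f k t = σ k t := by
      intro k t ht
      cases t <;> first | rfl | simp [Term.isThird] at ht
    refine ⟨fun k t ↦ if k = true ∧ t ∈ φ.matrix.fv true then σ.withThird f k t else σ k t, ?_,
      fun k t ↦ if t ∈ φ.matrix.fv k then σ.withThird f k t else σ k t, ?_, ?_⟩
    · intro k t ht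
      dsimp only
      by_cases h3 : t.isThird = true
      · exact if_neg fun hk ↦ ht ⟨hk.1, h3, hk.2⟩
      · rw [hth k t (by simpa using h3), ite_self]
    · intro k t ht
      dsimp only
      by_cases h3 : t.isThird = true
      · cases k
        · rw [if_neg fun hk ↦ ht ⟨rfl, h3, hk⟩]
          simp
        · simp
      · rw [hth k t (by simpa using h3), ite_self, ite_self]
    · refine (Fm.holds_congr fun k t ht ↦ ?_).1 h
      exact (if_pos ht).symm

section Schema

variable {k : ℕ} {U : Fin k → Dom}

/-- The value of a domain that is given by a constant and a rational number. -/
def Dom.mk : (s : Dom) → Const → ℚ → s.Carrier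
  | .D, c, _ => c
  | .Q, _, q => q

theorem Dom.toConst_mk {s : Dom} (h : s = .D) (c : Const) (q : ℚ) :
    s.toConst (Dom.mk s c q) = c := by
  subst h; rfl

theorem Dom.toRat_mk {s : Dom} (h : s = .Q) (c : Const) (q : ℚ) :
    s.toRat (Dom.mk s c q) = q := by
  subst h; rfl

theorem Var.isAttr_cases {s : Dom} {v : Var} (h : v.IsAttr U s) :
    ∃ i, ∃ hi : i < k, U ⟨i, hi⟩ = s ∧ (v = .left i ∨ v = .right i) := by
  cases v with
  | left i => exact ⟨i, h.1, h.2, .inl rfl⟩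
  | right i => exact ⟨i, h.1, h.2, .inr rfl⟩
  | bound n => exact h.elim

/-- The translated formula is evaluated at the tuples `t₁` (or `t₂`) and `t₃`, if `f` gives the
values of the attributes of `t₃`. -/
theorem ERO.holds_trans_iff_rel (e : Const ≃ ℚ) {φ : ERO} (hφ : φ.IsPrefFormula U)
    (t₁ t₂ t₃ : Tuple U) (f : Bool → ℕ → ℚ)
    (hD : ∀ i (hi : i < k), U ⟨i, hi⟩ = .D → f false i = e (assignD t₃ t₃ (.right i)))
    (hQ : ∀ i (hi : i < k), U ⟨i, hi⟩ = .Q → f true i = assignQ t₃ t₃ (.right i)) (b : Bool) :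
    (φ.trans b).Holds ((termVal e (assignD t₁ t₂) (assignQ t₁ t₂)).withThird f) ↔
      φ.rel U (if b then t₂ else t₁) t₃ := by
  rw [ERO.holds_trans (e := e) ⟨fun _ ↦ rfl, fun _ ↦ rfl⟩, ERO.rel]
  refine ERO.holds_congr (fun v hv ↦ ?_) (fun v hv ↦ ?_)
  · obtain ⟨i, hi, hU, rfl | rfl⟩ := Var.isAttr_cases (hφ.1 v hv)
    · cases b <;> simp [ren, Assign.withThird, termVal, assignD]
    · simp [ren, Assign.withThird, hD i hi hU, assignD]
  · obtain ⟨i, hi, hU, rfl | rfl⟩ := Var.isAttr_cases (hφ.2 v hv)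
    · cases b <;> simp [ren, Assign.withThird, termVal, assignQ]
    · simp [ren, Assign.withThird, hQ i hi hU, assignQ]

theorem ERO.holds_extFm_iff_rel (e : Const ≃ ℚ) {φ : ERO} (hφ : φ.IsPrefFormula U)
    (t₁ t₂ : Tuple U) :
    φ.extFm.Holds (termVal e (assignD t₁ t₂) (assignQ t₁ t₂)) ↔
      ∃ t₃, φ.rel U t₁ t₃ ∧ ¬ φ.rel U t₂ t₃ := by
  have hm : ∀ σ, φ.matrix.Holds σ ↔ (φ.trans false).Holds σ ∧ ¬ (φ.trans true).Holds σ := by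
    intro σ
    simp only [matrix, Fm.Holds]
    tauto
  simp only [ERO.holds_extFm, hm]
  constructor
  · rintro ⟨f, h⟩
    refine ⟨fun i ↦ Dom.mk (U i) (e.symm (f false i)) (f true i), ?_⟩
    have key := ERO.holds_trans_iff_rel e hφ t₁ t₂
      (fun i ↦ Dom.mk (U i) (e.symm (f false i)) (f true i)) f
      (fun i hi hU ↦ by simp [assignD, hi, Dom.toConst_mk hU])
      (fun i hi hU ↦ by simp [assignQ, hi, Dom.toRat_mk hU])
    rwa [key, key] at h
  · rintro ⟨t₃, h⟩
    let f : Bool → ℕ → ℚ := fun k i ↦ if k then assignQ t₃ t₃ (.right i) else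
      e (assignD t₃ t₃ (.right i))
    refine ⟨f, ?_⟩
    have key := ERO.holds_trans_iff_rel e hφ t₁ t₂ t₃ f (fun i hi hU ↦ by simp [f])
      (fun i hi hU ↦ by simp [f])
    rw [key, key]
    exact h

/-- The domain of the variables of a sort. -/
def sortDom : Bool → Dom
  | false => .D
  | true => .Q

theorem ERO.IsPrefFormula.isAttr {φ : ERO} (hφ : φ.IsPrefFormula U) {s : Bool} {v : Var}
    (hv : v ∈ φ.free s) : v.IsAttr U (sortDom s) := by
  cases s
  · exact hφ.1 v hv
  · exact hφ.2 v hv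

/-- After the elimination of the quantifiers, the free terms are attributes of the first two tuples
and constants. -/
theorem ERO.mem_fv_qe_extFm {φ : ERO} (hφ : φ.IsPrefFormula U) {s : Bool} {t : Term}
    (h : t ∈ φ.extFm.qe.fv s) :
    t.HasSort s ∧ ∀ v, t = .var v → v.IsAttr U (sortDom s) := by
  obtain ⟨h, h₁⟩ := Fm.mem_fv_exs (Fm.fv_qe_subset _ _ _ h)
  obtain ⟨h, h₂⟩ := Fm.mem_fv_exs h
  have h3 : t.isThird = false := by
    by_contra h3
    cases s
    · exact h₂ ⟨rfl, by simpa using h3, h⟩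
    · exact h₁ ⟨rfl, by simpa using h3, h⟩
  have hb : ∃ b, t ∈ (φ.trans b).fv s := by
    simp only [matrix, Fm.fv, List.append_nil, List.mem_append] at h
    exact h.elim (fun h ↦ ⟨_, h⟩) fun h ↦ ⟨_, h⟩
  obtain ⟨b, hb⟩ := hb
  rcases ERO.mem_fv_trans hb with ⟨v, hv, rfl⟩ | ⟨rfl, c, rfl⟩ | ⟨rfl, q, rfl⟩
  · obtain ⟨i, hi, hU, rfl | rfl⟩ := Var.isAttr_cases (hφ.isAttr hv)
    · refine ⟨by cases s <;> trivial, ?_⟩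
      rintro v hv
      cases b <;> simp only [ren, Bool.false_eq_true, if_true, if_false, Term.var.injEq] at hv <;>
        subst hv <;> exact ⟨hi, hU⟩
    · simp [ren, Term.isThird] at h3
  · exact ⟨trivial, by simp⟩
  · exact ⟨trivial, by simp⟩

theorem ERO.plain_qe_extFm {φ : ERO} (hφ : φ.IsPrefFormula U) : φ.extFm.qe.Plain :=
  Fm.plain_of_qf (Fm.qf_qe _) fun _ _ ht ↦ (ERO.mem_fv_qe_extFm hφ ht).1

end Schema

/-! ### Weak order extensions of interval orders -/

/-- In an interval order, the sets of dominated elements form a chain: this is what the interval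
condition says. So comparing elements by strict inclusion of these sets gives a weak order. -/
theorem IsIntervalOrder.isWeakOrder {α : Type*} {r : α → α → Prop} (h : IsIntervalOrder r) :
    IsWeakOrder fun x y ↦ ∃ z, r x z ∧ ¬ r y z := by
  have hneg : ∀ x y z, (¬ ∃ w, r x w ∧ ¬ r y w) → (¬ ∃ w, r y w ∧ ¬ r z w) →
      ¬ ∃ w, r x w ∧ ¬ r z w := by
    intro x y z hxy hyz
    push Not at hxy hyz ⊢
    exact fun w hw ↦ hyz w (hxy w hw)
  refine { irrefl := ?_, trans := ?_, negTrans := hneg }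
  · rintro x ⟨z, h1, h2⟩
    exact h2 h1
  · rintro x y z ⟨u, hxu, hyu⟩ ⟨v, hyv, hzv⟩
    rcases h.interval x u y v hxu hyv with h' | h'
    · exact ⟨v, h', hzv⟩
    · exact (hyu h').elim

theorem IsSPO.exists_rel_and_not_rel {α : Type*} {r : α → α → Prop} (h : IsSPO r) {x y : α}
    (hxy : r x y) : ∃ z, r x z ∧ ¬ r y z :=
  ⟨y, hxy, h.irrefl y⟩

/-! ### The time bound -/

/-- For a formula of polynomial size, a power of `Fm.qeBound` is singly exponential. -/
theorem exists_polynomial_bound (j k : ℕ) : ∃ p : Polynomial ℕ, ∀ (n : ℕ) (φ : Fm),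
    φ.enc.size ≤ (n + 2) ^ j → (n + φ.qeBound + 2) ^ k ≤ 2 ^ p.eval n := by
  refine ⟨(100 * ((Polynomial.X + 2) ^ j) ^ 2 + Polynomial.X + 2) * (k : Polynomial ℕ),
    fun n φ h ↦ ?_⟩
  have he : ((100 * ((Polynomial.X + 2) ^ j) ^ 2 + Polynomial.X + 2) * (k : Polynomial ℕ)).eval n =
      (100 * ((n + 2) ^ j) ^ 2 + n + 2) * k := by
    simp [Polynomial.eval_mul, Polynomial.eval_pow]
  rw [he, pow_mul]
  refine Nat.pow_le_pow_left ?_ k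
  generalize (n + 2) ^ j = s at *
  have h1 : φ.qeBound ≤ 2 ^ (100 * s ^ 2) := by
    calc φ.qeBound ≤ (2 ^ (100 * φ.enc.size)) ^ φ.enc.size :=
          Nat.pow_le_pow_left (Nat.lt_two_pow_self).le _
      _ = 2 ^ (100 * φ.enc.size ^ 2) := by rw [← pow_mul]; ring_nf
      _ ≤ _ := Nat.pow_le_pow_right (by omega)
          (Nat.mul_le_mul_left _ (Nat.pow_le_pow_left h 2))
  have h2 : n + 2 ≤ 2 ^ (n + 1) := Nat.lt_two_pow_self
  have h3 : 2 ^ (100 * s ^ 2) ≤ 2 ^ (100 * s ^ 2 + n + 1) :=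
    Nat.pow_le_pow_right (by omega) (by omega)
  have h4 : 2 ^ (n + 1) ≤ 2 ^ (100 * s ^ 2 + n + 1) :=
    Nat.pow_le_pow_right (by omega) (by omega)
  have h5 : 2 ^ (100 * s ^ 2 + n + 2) = 2 * 2 ^ (100 * s ^ 2 + n + 1) := by ring
  omega

end EROPref

theorem mainTheorem12 :
    ∃ (P : Program) (p : Polynomial ℕ),
      ∀ (φ : ERO) (k : ℕ) (U : Fin k → Dom),
        φ.IsPrefFormula U → IsIntervalOrder (φ.rel U) →
          ∃ ψ : ERO,
            ψ.IsPrefFormula U ∧ ψ.QuantifierFree ∧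
            IsWeakOrder (ψ.rel U) ∧
            (∀ t₁ t₂ : Tuple U, φ.rel U t₁ t₂ → ψ.rel U t₁ t₂) ∧
            ∃ t : ℕ, t ≤ 2 ^ p.eval φ.enc.size ∧ P.OutputsIn φ.enc ψ.enc t := by
  obtain ⟨m, hm⟩ := computes_toERO_qe_extFm
  -- the main function is number `0`, and its auxiliary functions follow it
  obtain ⟨P, e, hP⟩ := hm 1
  obtain ⟨j, hj⟩ := computes_extFm.size_le
  obtain ⟨p, hp⟩ := exists_polynomial_bound j (1 + m + 2)
  refine ⟨[e] ++ P, p, fun φ k U hφ hr ↦ ?_⟩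
  have hplain := ERO.plain_qe_extFm hφ
  obtain ⟨code⟩ : Nonempty (Const ≃ ℚ) := inferInstance
  have hrel : φ.extFm.qe.toERO.rel U = fun t₁ t₂ ↦ ∃ t₃, φ.rel U t₁ t₃ ∧ ¬ φ.rel U t₂ t₃ := by
    funext t₁ t₂
    rw [ERO.rel, Fm.holds_toERO code hplain, Fm.holds_qe, ERO.holds_extFm_iff_rel code hφ]
  refine ⟨φ.extFm.qe.toERO, ⟨?_, ?_⟩, Fm.quantifierFree_toERO _, ?_, ?_, ?_⟩
  · exact fun v hv ↦ (ERO.mem_fv_qe_extFm hφ (Fm.mem_free_toERO (k := false) hv)).2 v rfl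
  · exact fun v hv ↦ (ERO.mem_fv_qe_extFm hφ (Fm.mem_free_toERO (k := true) hv)).2 v rfl
  · rw [hrel]
    exact hr.isWeakOrder
  · rw [hrel]
    exact fun t₁ t₂ h ↦ hr.exists_rel_and_not_rel h
  · obtain ⟨t, ht, hE⟩ := hP [e] [] rfl φ hplain
    refine ⟨φ.enc.size + t + 1, ?_, .call rfl (.arg _) (by simpa using hE)⟩
    refine le_trans (add_pow_le_pow (k := 1) ?_ ht) (hp _ _ (hj φ trivial))
    show _ ≤ (φ.enc.size + φ.extFm.qeBound + 2) ^ 1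
    rw [pow_one]; omega
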